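/- **Setting.** Let $V$ be a finite-dimensional real Euclidean space with inner product $\langle-,-\rangle$ and let $\Phi\subseteq V\setminus\{0\}$ be a finite root system: $s_\alpha(\beta)\in\Phi$ for all $\alpha,\beta\in\Phi$, where $s_\alpha$ is the orthogonal reflection in $\alpha^\perp$, and $\alpha,c\alpha\in\Phi$ with $c\in\mathbb R$ implies $c=\pm1$. ($\Phi$ need neither be crystallographic nor span $V$.) Let $\Pi$ be a simple system of $\Phi$, that is, a linearly independent subset of $\Phi$ such that $\Phi$ is the disjoint union of $\Phi_+:=\Phi\cap\mathbb R_{\ge0}\Pi$ and $-\Phi_+$. Put $S=\{s_\alpha\mid\alpha\in\Pi\}$, so $|S|=|\Pi|$, and let $W=\langle s_\alpha\mid\alpha\in\Phi\rangle$. For $I\subseteq S$ write $\Pi_I=\{\alpha\in\Pi\mid s_\alpha\in I\}$. Fix an integer $n\ge1$. For $J\subseteq I\subseteq S$ let $$\mathcal C_{I,J}=\{v\in V\mid\langle\alpha,v\rangle=0\text{ for }\alpha\in\Pi_J,\ \langle\alpha,v\rangle>0\text{ for }\alpha\in\Pi_{I\setminus J}\}.$$ For a sequence $\mathbf I=(I_0,\dots,I_n)$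 with $S=I_0\supseteq I_1\supseteq\cdots\supseteq I_n$ let $\mathcal X_{\mathbf I}=\mathcal C_{I_0,I_1}\times\cdots\times\mathcal C_{I_{n-1},I_n}\subseteq V^n$. The *strata* are the sets $w(\mathcal X_{\mathbf I})$ with $w\in W$ (acting diagonally on $V^n$). Let $\mathcal F$ be the set of strata, ordered by $F\le G\iff\overline F\subseteq\overline G$, and let $\hat0:=\mathcal X_{(S,\dots,S)}$. Let $\overline{\mathcal F}$ be the set of pairs $(w,\mathbf I)$ with $\mathbf I$ as above, $w\in W$ and $w(\Pi_{I_n})\subseteq\Phi_+$, with the order transferred from $\mathcal F$ along the map $(w,\mathbf I)\mapsto w(\mathcal X_{\mathbf I})$. The element $(1,(S,\dots,S))$ of $\overline{\mathcal F}$ is also denoted $\hat0$. For a finite-dimensional real vector space $U$ let $\mathcal R_U$ be the set of rays $\mathbb R_{>0}v$, $0\ne v\in U$, topologised so that $v\mapsto\mathbb R_{>0}v$ is a homeomorphism from the unit sphere of a norm on $U$ onto $\mathcal R_U$ (the topology does not depend on the norm). For $C\subseteq U$ let $[C]=\{\mathbb R_{>0}v\mid 0\neq v\in C\}$. A *regular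 cell decomposition* of a Hausdorff space $T$ is given by a finite partition of $T$ into sets $e$ (the open cells) such that each closed cell $\overline e$ is homeomorphic to a closed Euclidean ball by a homeomorphism under which $e$ corresponds to the open ball, and such that $\overline e\setminus e$ is a union of closed cells. Its *face poset* is the set of closed cells ordered by inclusion. Let $\mathbb S^{m-1}$ be the unit sphere in $\mathbb R^m$ ($\mathbb S^{-1}=\emptyset$). **Proposition 4.3.** The relation $\le$ is a partial order on $\mathcal F$ with minimum element $\hat0$, and $(w,\mathbf I)\mapsto w(\mathcal X_{\mathbf I})$ is a bijection $\overline{\mathcal F}\to\mathcal F$. Moreover: (a) Suppose that $V=\mathbb R\Pi$. Then $d:=\dim V=|S|$, $\mathcal R_{V^n}\cong\mathbb S^{nd-1}$, and $\{[F]\mid F\in\mathcal F\setminus\{\hat0\}\}$ is the set of open cells of a regular cell decomposition of $\mathcal R_{V^n}$. The map $F\mapsto\overline{[F]}$ is an isomorphism from the poset $\mathcal F\setminus\{\hat0\}$ onto the face poset of this decomposition. (b) In general (without assuming $V=\mathbb R\Pi$), the poset $\overline{\mathcal F}\setminus\{\hat0\}$ is isomorphic to the face poset of a regular cell decomposition of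 $\mathbb S^{n|S|-1}$. Consequently the poset $\overline{\mathcal F}\cup\{\hat1\}$, obtained from $\overline{\mathcal F}$ by adjoining a new maximum element $\hat1$, is finite and graded: it has a minimum and a maximum element, and all its maximal chains have the same cardinality. -/

import Mathlib

open scoped NNReal

noncomputable section

namespace DiagonalStrata

section Euclidean

variable {V : Type*} [NormedAddCommGroup V] [InnerProductSpace ℝ V]

/-- The orthogonal reflection `s_α` in the hyperplane perpendicular to `α`
(for `α ≠ 0`, it is `v ↦ v - 2 ⟪v, α⟫ / ⟪α, α⟫ • α`). -/
def rootRefl (α : V) : V ≃ₗᵢ[ℝ] V := (Submodule.span ℝ {α})ᗮ.reflection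

/-- A finite, reduced, not necessarily crystallographic root system in `V`; it need not span `V`. -/
structure IsRootSystem (Φ : Set V) : Prop where
  finite : Φ.Finite
  zero_notMem : (0 : V) ∉ Φ
  refl_mem : ∀ α ∈ Φ, ∀ β ∈ Φ, rootRefl α β ∈ Φ
  reduced : ∀ α ∈ Φ, ∀ c : ℝ, c • α ∈ Φ → c = 1 ∨ c = -1

/-- `Φ₊ = Φ ∩ ℝ_{≥0} Δ`. -/
def posRoots (Φ Δ : Set V) : Set V := Φ ∩ (Submodule.span ℝ≥0 Δ : Set V)

/-- `Δ` is a simple system of `Φ`: a linearly independent subset of `Φ` such that `Φ` is the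
disjoint union of `Φ₊` and `-Φ₊`. -/
structure IsSimpleSystem (Φ Δ : Set V) : Prop where
  subset : Δ ⊆ Φ
  linearIndep : LinearIndepOn ℝ id Δ
  union_eq : posRoots Φ Δ ∪ -posRoots Φ Δ = Φ
  disjoint : Disjoint (posRoots Φ Δ) (-posRoots Φ Δ)

/-- The reflection group `W` generated by the reflections in the roots. -/
def weylGroup (Φ : Set V) : Subgroup (V ≃ₗᵢ[ℝ] V) := Subgroup.closure (rootRefl '' Φ)

/-- The cone `C_{I,J}` of those `v` with `⟪α, v⟫ = 0` for `α ∈ J` and `⟪α, v⟫ > 0` for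
`α ∈ I \ J`. Throughout, a set of simple reflections is represented by the set of the
corresponding simple roots (`α ↦ s_α` is a bijection from the simple roots to the simple
reflections). -/
def facetCone (I J : Set V) : Set V :=
  {v | (∀ α ∈ J, inner ℝ α v = 0) ∧ ∀ α ∈ I \ J, 0 < inner ℝ α v}

/-- The weakly decreasing sequences `Δ = I₀ ⊇ I₁ ⊇ ⋯ ⊇ Iₙ`. -/
def flags (Δ : Set V) (n : ℕ) : Set (Fin (n + 1) → Set V) := {I | I 0 = Δ ∧ Antitone I}

/-- `X_I = C_{I₀,I₁} × C_{I₁,I₂} × ⋯ × C_{Iₙ₋₁,Iₙ} ⊆ Vⁿ`. -/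
def stdStratum {n : ℕ} (I : Fin (n + 1) → Set V) : Set (Fin n → V) :=
  {v | ∀ i : Fin n, v i ∈ facetCone (I i.castSucc) (I i.succ)}

/-- `w(X_I)`, for the diagonal action of `w` on `Vⁿ`. -/
def translate {n : ℕ} (w : V ≃ₗᵢ[ℝ] V) (I : Fin (n + 1) → Set V) : Set (Fin n → V) :=
  (fun v i => w (v i)) '' stdStratum I

/-- The set `F⁽ⁿ⁾` of strata `w(X_I)` of `Vⁿ`. -/
structure Stratum (Φ Δ : Set V) (n : ℕ) where
  carrier : Set (Fin n → V)
  exists_eq : ∃ w ∈ weylGroup Φ, ∃ I ∈ flags Δ n, carrier = translate w I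

/-- `F ≤ G` if and only if `closure F ⊆ closure G`. -/
instance (Φ Δ : Set V) (n : ℕ) : Preorder (Stratum Φ Δ n) :=
  Preorder.lift fun F => closure F.carrier

/-- The stratum `0̂ = X_{(S, …, S)}`. -/
def Stratum.zero (Φ Δ : Set V) (n : ℕ) : Stratum Φ Δ n where
  carrier := translate 1 fun _ => Δ
  exists_eq := ⟨1, one_mem _, fun _ => Δ, ⟨rfl, antitone_const⟩, rfl⟩

/-- The set of pairs `(w, I)` with `I` a weakly decreasing sequence as above and `w ∈ W^{Iₙ}`,
i.e. `w ∈ W` maps the simple roots in `Iₙ` to positive roots. -/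
structure StratumIndex (Φ Δ : Set V) (n : ℕ) where
  w : V ≃ₗᵢ[ℝ] V
  I : Fin (n + 1) → Set V
  w_mem : w ∈ weylGroup Φ
  I_mem : I ∈ flags Δ n
  mapsTo : ∀ α ∈ I (Fin.last n), w α ∈ posRoots Φ Δ

/-- The map `(w, I) ↦ w(X_I)`. -/
def StratumIndex.toStratum {Φ Δ : Set V} {n : ℕ} (p : StratumIndex Φ Δ n) : Stratum Φ Δ n where
  carrier := translate p.w p.I
  exists_eq := ⟨p.w, p.w_mem, p.I, p.I_mem, rfl⟩

/-- The order transferred from the strata: `(w, I) ≤ (w', I')` iff `w(X_I) ≤ w'(X_{I'})`. -/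
instance (Φ Δ : Set V) (n : ℕ) : Preorder (StratumIndex Φ Δ n) :=
  Preorder.lift StratumIndex.toStratum

/-- The index `(1, (S, …, S))` of the stratum `0̂`. -/
def StratumIndex.zero {Φ Δ : Set V} (h : Δ ⊆ Φ) (n : ℕ) : StratumIndex Φ Δ n where
  w := 1
  I := fun _ => Δ
  w_mem := one_mem _
  I_mem := ⟨rfl, antitone_const⟩
  mapsTo := fun _ hα => ⟨h hα, Submodule.subset_span hα⟩

end Euclidean

section Rays

/-- The set of rays `ℝ_{>0} v`, `v ≠ 0`, in `U`. -/
def RaySpace (U : Type*) [AddCommGroup U] [Module ℝ U] : Type _ := Module.Ray ℝ U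

variable {U : Type*} [NormedAddCommGroup U] [NormedSpace ℝ U]

/-- The bijection `v ↦ ℝ_{>0} v` from the boundary of the closed unit ball to the rays. -/
def sphereToRay (v : Metric.sphere (0 : U) 1) : RaySpace U :=
  rayOfNeZero ℝ (v : U) (ne_zero_of_mem_unit_sphere v)

/-- The topology on the rays for which `sphereToRay` is a homeomorphism. (For finite-dimensional
`U`, it does not depend on the norm: the closed unit balls of all norms, and more generally all
convex bodies with `0` in the interior, give the same topology.) -/
instance : TopologicalSpace (RaySpace U) :=
  TopologicalSpace.coinduced (sphereToRay (U := U)) inferInstance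

/-- `[C]`, the set of rays spanned by the non-zero elements of `C`. -/
def raysOf (C : Set U) : Set (RaySpace U) :=
  {r | ∃ v ∈ C, ∃ hv : v ≠ 0, r = (rayOfNeZero ℝ v hv : Module.Ray ℝ U)}

end Rays

section Cells

variable {T : Type*} [TopologicalSpace T]

/-- `E` is the set of open cells of a regular cell decomposition of the Hausdorff space `T`: a
finite partition of `T` such that the closure of each `e ∈ E` is a ball with interior `e` (there is
a homeomorphism from a closed Euclidean ball onto `closure e` mapping the open ball onto `e`), and
the boundary `closure e \ e` of each such ball is a union of closed cells. -/
structure IsRegularCellDecomposition (E : Set (Set T)) : Prop where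
  t2 : T2Space T
  finite : E.Finite
  pairwiseDisjoint : E.PairwiseDisjoint id
  sUnion_eq : ⋃₀ E = Set.univ
  isBall : ∀ e ∈ E, ∃ k : ℕ,
    ∃ h : Metric.closedBall (0 : EuclideanSpace ℝ (Fin k)) 1 ≃ₜ closure e,
      (fun x => (h x : T)) '' {x | (x : EuclideanSpace ℝ (Fin k)) ∈ Metric.ball 0 1} = e
  boundary : ∀ e ∈ E, ∃ A ⊆ E, closure e \ e = ⋃ a ∈ A, closure a

/-- The face poset of a regular cell decomposition with set of open cells `E`: the set of the
closed cells, ordered by inclusion (as a subtype of `Set T`). -/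
abbrev FacePoset (E : Set (Set T)) : Type _ := {c : Set T // ∃ e ∈ E, c = closure e}

end Cells

/-- A poset is graded if it has a minimum and a maximum and all its maximal chains have the same
cardinality. -/
def IsGradedPoset (P : Type*) [Preorder P] : Prop :=
  (∀ a b : P, a ≤ b → b ≤ a → a = b) ∧ (∃ a : P, IsBot a) ∧ (∃ a : P, IsTop a) ∧
    ∀ C D : Set P, IsMaxChain (· ≤ ·) C → IsMaxChain (· ≤ ·) D → C.encard = D.encard

/-- The standard sphere `S^{m-1}` in `ℝ^m` (empty for `m = 0`). -/
abbrev StdSphere (m : ℕ) : Type := Metric.sphere (0 : EuclideanSpace ℝ (Fin m)) 1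

end DiagonalStrata

end

/-! The strata are the cells of a lexicographic sign stratification. For a root `β` and `x` in `Vⁿ`,
read the sequence of the values `⟪β, x i⟫` up to its first non-zero entry; `rootSigns` records this
for all roots at once. Two points lie in the same stratum iff they have the same signs
(`translate_eq_lexCell`), and one stratum lies in the closure of another iff the sign sets are
included in the reverse direction (`Stratum.le_iff`). The topology can therefore be treated for any
finite family of sequences of linear forms that is closed under negation.

For such a family, each cell is cut out by equations and strict inequalities
(`lexCell_eq_formCone`), and its closure by the weak inequalities (`closure_lexCell`). If the forms
separate points, the rays in a cell other than that of `0` form an open ball whose closure is a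
closed ball (`isOpenBallCell_raysOf_formCone`), so the cells give a regular decomposition of the ray
sphere with the sign order as face order.

Root combinatorics identifies the cells. Some `w` in the reflection group makes a tuple
lexicographically dominant, and a dominant tuple lies in a standard stratum; hence the translates
cover `Vⁿ` (`StratumIndex.exists_mem`). The index is unique because a group element sending simple
roots to positive roots is trivial (`StratumIndex.eq_of_mem`). If the simple roots do not span `V`,
orthogonal projection to their span preserves all signs, which reduces the general sphere statement
to the spanning case.

Gradedness is proved by means of the rank function `strataRank`: strictly below a stratum and above
any given smaller one there is a stratum of rank one less (`exists_facet`), and every stratum lies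
below one of the top rank (`exists_top_rank`). -/

noncomputable section

namespace DiagonalStrata

/-! ### Cones cut out by linear forms -/

section Cones

variable {U : Type*} [AddCommGroup U] [Module ℝ U]

/-- A set stable under multiplication by positive scalars. -/
def IsConic (C : Set U) : Prop := ∀ t : ℝ, 0 < t → ∀ x ∈ C, t • x ∈ C

/-- The cone of the vectors on which some linear forms vanish and others are positive. -/
def formCone {κ : Type*} (f : κ → U →ₗ[ℝ] ℝ) (K₀ K₁ : Set κ) : Set U :=
  {x | (∀ k ∈ K₀, f k x = 0) ∧ ∀ k ∈ K₁, 0 < f k x}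

end Cones

/-! ### Topology of the space of rays -/

section RayTopology

variable {U : Type*} [NormedAddCommGroup U] [NormedSpace ℝ U]

/-- The ray of a non-zero vector. -/
def rayOf (v : {v : U // v ≠ 0}) : RaySpace U := rayOfNeZero ℝ v.1 v.2

theorem rayOf_eq_iff (v w : {v : U // v ≠ 0}) :
    rayOf v = rayOf w ↔ ∃ t : ℝ, 0 < t ∧ w.1 = t • v.1 := by
  have h : rayOf v = rayOf w ↔ SameRay ℝ v.1 w.1 := ray_eq_iff v.2 w.2
  rw [h]
  constructor
  · intro h
    obtain ⟨t, ht, h⟩ := h.exists_pos_left v.2 w.2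
    exact ⟨t, ht, h.symm⟩
  · rintro ⟨t, ht, h⟩
    rw [h]
    exact SameRay.sameRay_pos_smul_right v.1 ht

theorem rayOf_surjective : Function.Surjective (rayOf (U := U)) := by
  intro r
  induction r using Module.Ray.ind with
  | h v hv => exact ⟨⟨v, hv⟩, rfl⟩

/-- The unit vector in the direction of a non-zero vector. -/
def unitVector (v : {v : U // v ≠ 0}) : Metric.sphere (0 : U) 1 :=
  ⟨‖v.1‖⁻¹ • v.1, by simp [norm_smul, v.2]⟩

theorem continuous_unitVector : Continuous (unitVector (U := U)) := by
  refine Continuous.subtype_mk ?_ _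
  exact (continuous_subtype_val.norm.inv₀ fun v => norm_ne_zero_iff.2 v.2).smul
    continuous_subtype_val

theorem sphereToRay_unitVector (v : {v : U // v ≠ 0}) : sphereToRay (unitVector v) = rayOf v :=
  (rayOf_eq_iff ⟨_, ne_zero_of_mem_unit_sphere (unitVector v)⟩ v).2
    ⟨‖v.1‖, norm_pos_iff.2 v.2, by simp [unitVector, smul_smul, v.2]⟩

theorem continuous_rayOf : Continuous (rayOf (U := U)) := by
  have h : rayOf (U := U) = sphereToRay ∘ unitVector := by
    ext1 v
    exact (sphereToRay_unitVector v).symm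
  rw [h]
  exact continuous_coinduced_rng.comp continuous_unitVector

theorem sphereToRay_bijective : Function.Bijective (sphereToRay (U := U)) := by
  constructor
  · intro v w h
    have h' : SameRay ℝ v.1 w.1 :=
      (ray_eq_iff (ne_zero_of_mem_unit_sphere v) (ne_zero_of_mem_unit_sphere w)).1 h
    exact Subtype.ext (h'.eq_of_norm_eq (by simp))
  · intro r
    obtain ⟨v, rfl⟩ := rayOf_surjective r
    exact ⟨unitVector v, sphereToRay_unitVector v⟩

/-- The homeomorphism from the unit sphere to the space of rays. -/
def sphereHomeoRay : Metric.sphere (0 : U) 1 ≃ₜ RaySpace U :=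
  (Equiv.ofBijective sphereToRay sphereToRay_bijective).toHomeomorph fun _ => Iff.rfl

instance : T2Space (RaySpace U) := (sphereHomeoRay (U := U)).t2Space

theorem continuous_raySpace_iff {X : Type*} [TopologicalSpace X] {g : RaySpace U → X} :
    Continuous g ↔ Continuous (g ∘ rayOf) := by
  refine ⟨fun h => h.comp continuous_rayOf, fun h => continuous_coinduced_dom.2 ?_⟩
  have : Continuous fun v : Metric.sphere (0 : U) 1 =>
      (⟨v.1, ne_zero_of_mem_unit_sphere v⟩ : {v : U // v ≠ 0}) := by fun_prop
  exact h.comp this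

/-- A linear homeomorphism induces a homeomorphism of the spaces of rays. -/
def rayHomeo {U' : Type*} [NormedAddCommGroup U'] [NormedSpace ℝ U'] (e : U ≃L[ℝ] U') :
    RaySpace U ≃ₜ RaySpace U' where
  toEquiv := Module.Ray.map e.toLinearEquiv
  continuous_toFun := by
    rw [continuous_raySpace_iff]
    have : Continuous fun v : {v : U // v ≠ 0} =>
        (⟨e v.1, by simpa using v.2⟩ : {v : U' // v ≠ 0}) := by fun_prop
    exact continuous_rayOf.comp this
  continuous_invFun := by
    rw [continuous_raySpace_iff]
    have : Continuous fun v : {v : U' // v ≠ 0} =>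
        (⟨e.symm v.1, by simpa using v.2⟩ : {v : U // v ≠ 0}) := by fun_prop
    exact continuous_rayOf.comp this

/-- The space of rays of an `m`-dimensional space is a sphere of dimension `m - 1`. -/
def raySpaceHomeoSphere {m : ℕ} (e : U ≃L[ℝ] EuclideanSpace ℝ (Fin m)) :
    RaySpace U ≃ₜ StdSphere m :=
  (rayHomeo e).trans sphereHomeoRay.symm

theorem raysOf_eq_image (C : Set U) : raysOf C = rayOf '' {v : {v : U // v ≠ 0} | v.1 ∈ C} := by
  ext r
  constructor
  · rintro ⟨v, hvC, hv, rfl⟩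
    exact ⟨⟨v, hv⟩, hvC, rfl⟩
  · rintro ⟨v, hvC, rfl⟩
    exact ⟨v.1, hvC, v.2, rfl⟩

theorem rayOf_mem_raysOf {C : Set U} (hC : IsConic C) (v : {v : U // v ≠ 0}) :
    rayOf v ∈ raysOf C ↔ v.1 ∈ C := by
  rw [raysOf_eq_image]
  constructor
  · rintro ⟨w, hw, h⟩
    obtain ⟨t, ht, h⟩ := (rayOf_eq_iff w v).1 h
    rw [h]
    exact hC t ht _ hw
  · exact fun h => ⟨v, h, rfl⟩

/-- Passing to rays loses nothing for conic sets: being in the closed cone can be tested on unit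
vectors, and non-zero vectors form an open set, so closures in it are restrictions of closures in
`U`. -/
theorem closure_raysOf {C : Set U} (hC' : IsConic (closure C)) :
    closure (raysOf C) = raysOf (closure C) := by
  apply Set.Subset.antisymm
  · apply closure_minimal
    · rw [raysOf_eq_image, raysOf_eq_image]
      exact Set.image_mono fun v hv => subset_closure hv
    · refine isClosed_coinduced.2 ?_
      have : (sphereToRay ⁻¹' raysOf (closure C)) =
          (fun v : Metric.sphere (0 : U) 1 => v.1) ⁻¹' closure C := by
        ext v
        exact rayOf_mem_raysOf hC' ⟨v.1, ne_zero_of_mem_unit_sphere v⟩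
      rw [this]
      exact isClosed_closure.preimage continuous_subtype_val
  · rw [raysOf_eq_image, raysOf_eq_image]
    refine subset_trans (Set.image_mono ?_) (image_closure_subset_closure_image continuous_rayOf)
    intro v hv
    have ho : IsOpen {v : U | v ≠ 0} := isOpen_ne
    have := ho.isOpenEmbedding_subtypeVal.isOpenMap.preimage_closure_eq_closure_preimage
      continuous_subtype_val C
    exact this.subset hv

end RayTopology

/-! ### Recognising closed balls -/

section Ball

variable {T : Type*} [TopologicalSpace T]

/-- The closure of `e` is a closed ball with interior `e`. -/
def IsOpenBallCell (e : Set T) : Prop :=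
  ∃ k : ℕ, ∃ h : Metric.closedBall (0 : EuclideanSpace ℝ (Fin k)) 1 ≃ₜ closure e,
    (fun x => (h x : T)) '' {x | (x : EuclideanSpace ℝ (Fin k)) ∈ Metric.ball 0 1} = e

/-- A continuous injection of a compact space into a Hausdorff space is a closed embedding. Its
range is the closure of the image of the open ball, since the open ball is dense in the closed one.
-/
theorem isOpenBallCell_of_injective [T2Space T] {k : ℕ}
    (φ : Metric.closedBall (0 : EuclideanSpace ℝ (Fin k)) 1 → T) (hφ : Continuous φ)
    (hinj : Function.Injective φ) :
    IsOpenBallCell (φ '' {x | (x : EuclideanSpace ℝ (Fin k)) ∈ Metric.ball 0 1}) := by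
  have hcl : Set.range φ =
      closure (φ '' {x | (x : EuclideanSpace ℝ (Fin k)) ∈ Metric.ball 0 1}) := by
    apply Set.Subset.antisymm
    · have hd : closure {x : Metric.closedBall (0 : EuclideanSpace ℝ (Fin k)) 1 |
          (x : EuclideanSpace ℝ (Fin k)) ∈ Metric.ball 0 1} = Set.univ := by
        refine Set.eq_univ_of_forall fun x => closure_subtype.2 ?_
        have : ((↑) '' {x : Metric.closedBall (0 : EuclideanSpace ℝ (Fin k)) 1 |
            (x : EuclideanSpace ℝ (Fin k)) ∈ Metric.ball 0 1}) =
            Metric.ball (0 : EuclideanSpace ℝ (Fin k)) 1 := by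
          ext y
          constructor
          · rintro ⟨z, hz, rfl⟩
            exact hz
          · exact fun hy => ⟨⟨y, Metric.ball_subset_closedBall hy⟩, hy, rfl⟩
        rw [this, closure_ball _ one_ne_zero]
        exact x.2
      rw [← Set.image_univ, ← hd]
      exact image_closure_subset_closure_image hφ
    · exact closure_minimal (Set.image_subset_range _ _) (isCompact_range hφ).isClosed
  have hemb : Topology.IsEmbedding φ := (hφ.isClosedEmbedding hinj).isEmbedding
  refine ⟨k, hemb.toHomeomorph.trans (Homeomorph.setCongr hcl), ?_⟩
  rfl

/-- The closed unit ball is homeomorphic to the closure of any non-empty bounded open convex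
set, compatibly with the interiors. -/
theorem exists_closedBall_param {D : Type*} [NormedAddCommGroup D] [NormedSpace ℝ D]
    [FiniteDimensional ℝ D] {s : Set D} (ho : IsOpen s) (hc : Convex ℝ s) (h0 : s.Nonempty)
    (hb : Bornology.IsBounded s) :
    ∃ (k : ℕ) (g : EuclideanSpace ℝ (Fin k) ≃ₜ D),
      g '' Metric.ball 0 1 = s ∧ g '' Metric.closedBall 0 1 = closure s := by
  let e := toEuclidean (E := D)
  have hs' : IsOpen (e '' s) := e.toHomeomorph.isOpenMap s ho
  obtain ⟨h, h1, h2, -⟩ := exists_homeomorph_image_interior_closure_frontier_eq_unitBall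
    (s := e '' s) (hc.linear_image e.toLinearMap) (by rw [hs'.interior_eq]; exact h0.image _)
    (e.lipschitz.isBounded_image hb)
  rw [hs'.interior_eq] at h1
  refine ⟨_, h.symm.trans e.symm.toHomeomorph, ?_, ?_⟩
  · rw [← h1]
    ext x; simp
  · rw [← h2]
    have : closure (e '' s) = e '' closure s := (e.toHomeomorph.image_closure s).symm
    rw [this]
    ext x; simp

end Ball

/-! ### The rays of a polyhedral cone form a ball -/

section ConeBall

variable {U : Type*} [NormedAddCommGroup U] [NormedSpace ℝ U] [FiniteDimensional ℝ U]

/-- One form positive on the cone is normalised to a height `ℓ` with `ℓ u = 1` at a point `u` of the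
cone. Each ray of the cone has a unique representative with `‖y‖ + ℓ = 1`, where `y` is its
component in `ker ℓ` along `u`; recording `y` maps the cone to a bounded open convex set. This works
even if the closure of the cone contains lines. -/
theorem isOpenBallCell_raysOf_formCone {κ : Type*} (f : κ → U →ₗ[ℝ] ℝ) (K₀ K₁ : Set κ)
    (hfin : K₁.Finite) (hne : K₁.Nonempty) (hF : (formCone f K₀ K₁).Nonempty) :
    IsOpenBallCell (raysOf (formCone f K₀ K₁)) := by
  obtain ⟨k₁, hk₁⟩ := hne
  obtain ⟨u, hu₀, hu₁⟩ := hF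
  have huk := hu₁ k₁ hk₁
  let ℓ : U →ₗ[ℝ] ℝ := (f k₁ u)⁻¹ • f k₁
  have hℓu : ℓ u = 1 := by simp [ℓ, huk.ne']
  have hℓ : ∀ x, 0 < f k₁ x → 0 < ℓ x := fun x hx => by
    simp only [ℓ, LinearMap.smul_apply, smul_eq_mul]; positivity
  let D : Submodule ℝ U := (⨅ k ∈ K₀, LinearMap.ker (f k)) ⊓ LinearMap.ker ℓ
  have hD : ∀ x, x ∈ D ↔ (∀ k ∈ K₀, f k x = 0) ∧ ℓ x = 0 := fun x => by
    simp [D, Submodule.mem_inf, Submodule.mem_iInf]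
  -- The graph of the concave function `1 - ‖y‖` over `D`, in the direction of `u`.
  let ψ : D → U := fun y => y.1 + (1 - ‖y‖) • u
  have hψc : Continuous ψ := by fun_prop
  have hψℓ : ∀ y, ℓ (ψ y) = 1 - ‖y‖ := fun y => by
    simp [ψ, ((hD y.1).1 y.2).2, hℓu]
  have hψ0 : ∀ y, ψ y ≠ 0 := fun y hy => by
    have h1 := hψℓ y
    rw [hy, map_zero] at h1
    have h2 : y.1 + (1 - ‖y‖) • u = 0 := hy
    rw [← h1, zero_smul, add_zero] at h2
    have h3 : ‖y‖ = 0 := by simpa using h2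
    linarith
  let s : Set D := {y | ‖y‖ < 1 ∧ ∀ k ∈ K₁, 0 < f k (ψ y)}
  have hso : IsOpen s := by
    have : s = {y | ‖y‖ < 1} ∩ ⋂ k ∈ K₁, {y | 0 < f k (ψ y)} := by
      ext y; simp [s]
    rw [this]
    refine (isOpen_lt continuous_norm continuous_const).inter (hfin.isOpen_biInter fun k _ => ?_)
    exact isOpen_lt continuous_const
      ((LinearMap.continuous_of_finiteDimensional (f k)).comp hψc)
  -- For `k ∈ K₁` the function `f k ∘ ψ` is linear plus `f k u > 0` times the concave function `1 -
  -- ‖y‖`, hence concave, so its positivity set is convex.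
  have hsc : Convex ℝ s := by
    intro y hy z hz a b ha hb hab
    have hn : ‖a • y + b • z‖ ≤ a * ‖y‖ + b * ‖z‖ := by
      refine (norm_add_le _ _).trans (le_of_eq ?_)
      rw [norm_smul_of_nonneg ha, norm_smul_of_nonneg hb]
    constructor
    · rcases ha.eq_or_lt with rfl | ha
      · obtain rfl : b = 1 := by linarith
        simpa using hz.1
      · nlinarith [hy.1, hz.1]
    · intro k hk
      have hy' := hy.2 k hk
      have hz' := hz.2 k hk
      have hu' := hu₁ k hk
      simp only [ψ, map_add, map_smul, smul_eq_mul, Submodule.coe_add, Submodule.coe_smul]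
        at hy' hz' ⊢
      have key : 0 < a * (f k y + (1 - ‖y‖) * f k u) + b * (f k z + (1 - ‖z‖) * f k u) := by
        rcases ha.eq_or_lt with rfl | ha
        · obtain rfl : b = 1 := by linarith
          simpa using hz'
        · have := mul_pos ha hy'
          have := mul_nonneg hb hz'.le
          linarith
      have : 0 ≤ (a * ‖y‖ + b * ‖z‖ - ‖a • y + b • z‖) * f k u :=
        mul_nonneg (by linarith) hu'.le
      have : a * f k y + b * f k z + (1 - ‖a • y + b • z‖) * f k u =
        a * (f k y + (1 - ‖y‖) * f k u) + b * (f k z + (1 - ‖z‖) * f k u) +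
        (a * ‖y‖ + b * ‖z‖ - ‖a • y + b • z‖) * f k u := by
        linear_combination (-(f k u)) * hab
      linarith
  have hs0 : (0 : D) ∈ s := by
    refine ⟨by simp, fun k hk => ?_⟩
    simpa [ψ] using hu₁ k hk
  have hsb : s ⊆ Metric.closedBall 0 1 := fun y hy => by simpa using hy.1.le
  obtain ⟨m, g, hg1, hg2⟩ := exists_closedBall_param hso hsc ⟨0, hs0⟩
    (Metric.isBounded_closedBall.subset hsb)
  let φ : Metric.closedBall (0 : EuclideanSpace ℝ (Fin m)) 1 → RaySpace U :=
    fun x => rayOf ⟨ψ (g x.1), hψ0 _⟩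
  have hφ : Continuous φ := by
    refine continuous_rayOf.comp (Continuous.subtype_mk ?_ _)
    exact hψc.comp (g.continuous.comp continuous_subtype_val)
  have hφi : Function.Injective φ := by
    intro x x' h
    have hle : ∀ x : Metric.closedBall (0 : EuclideanSpace ℝ (Fin m)) 1, ‖g x.1‖ ≤ 1 := by
      intro x
      have h1 : g x.1 ∈ closure s := hg2 ▸ Set.mem_image_of_mem g x.2
      simpa using closure_minimal hsb Metric.isClosed_closedBall h1
    -- Proportional values of `ψ` have proportional heights and proportional components in `D`, with
    -- the same factor `t`. As height plus norm is `1` on both sides, `t = 1`.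
    obtain ⟨t, ht, h⟩ := (rayOf_eq_iff _ _).1 h
    replace h : ψ (g x'.1) = t • ψ (g x.1) := h
    have h1 := congrArg ℓ h
    rw [map_smul, hψℓ, hψℓ, smul_eq_mul] at h1
    have h2 : g x'.1 = t • g x.1 := by
      apply Subtype.ext
      simp only [ψ, smul_add, smul_smul, ← h1] at h
      simpa using h
    have h3 := congrArg norm h2
    rw [norm_smul_of_nonneg ht.le] at h3
    have h4 : t = 1 := by linarith
    rw [h4, one_smul] at h2
    exact Subtype.ext (g.injective h2.symm)
  have himage : φ '' {x | (x : EuclideanSpace ℝ (Fin m)) ∈ Metric.ball 0 1} =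
      raysOf (formCone f K₀ K₁) := by
    rw [raysOf_eq_image]
    apply Set.Subset.antisymm
    · rintro _ ⟨x, hx, rfl⟩
      refine ⟨_, ?_, rfl⟩
      have h1 : g x.1 ∈ s := hg1 ▸ Set.mem_image_of_mem g hx
      refine ⟨fun k hk => ?_, h1.2⟩
      simp [ψ, hu₀ k hk, ((hD _).1 (g x.1).2).1 k hk]
    · rintro _ ⟨⟨v, hv⟩, ⟨hv₀, hv₁⟩, rfl⟩
      have hℓv := hℓ v (hv₁ k₁ hk₁)
      let y₀ : D := ⟨v - ℓ v • u, (hD _).2 ⟨fun k hk => by simp [hv₀ k hk, hu₀ k hk],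
        by simp [hℓu]⟩⟩
      -- The scaling that puts `v` on the graph, where norm plus height equals `1`.
      let t := (‖y₀‖ + ℓ v)⁻¹
      have hpos : 0 < ‖y₀‖ + ℓ v := by positivity
      have ht : 0 < t := inv_pos.2 hpos
      have hty : ‖t • y₀‖ = t * ‖y₀‖ := norm_smul_of_nonneg ht.le _
      have ht1 : t * ‖y₀‖ + t * ℓ v = 1 := by
        rw [← mul_add]; exact inv_mul_cancel₀ hpos.ne'
      have hψy : ψ (t • y₀) = t • v := by
        have : 1 - ‖t • y₀‖ = t * ℓ v := by linarith
        simp only [ψ, this, Submodule.coe_smul, y₀, mul_smul, smul_sub, sub_add_cancel]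
      have hys : t • y₀ ∈ s := by
        refine ⟨by rw [hty]; nlinarith, fun k hk => ?_⟩
        rw [hψy, map_smul, smul_eq_mul]
        exact mul_pos ht (hv₁ k hk)
      rw [← hg1] at hys
      obtain ⟨x, hx, hxy⟩ := hys
      refine ⟨⟨x, Metric.ball_subset_closedBall hx⟩, hx, ?_⟩
      refine ((rayOf_eq_iff _ _).2 ⟨t, ht, ?_⟩).symm
      simp only [hxy]
      exact hψy
  rw [← himage]
  exact isOpenBallCell_of_injective φ hφ hφi

end ConeBall

/-! ### Lexicographic sign cells of a symmetric family of forms -/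

section Lex

variable {E : Type*} [AddCommGroup E] [Module ℝ E] {B : Type*} {n : ℕ}

/-- The pairs `(b, i)` such that the first `i` forms of the sequence `f b` vanish at `x` and the
next one is non-negative. -/
def lexNonneg (f : B → Fin n → E →ₗ[ℝ] ℝ) (x : E) : Set (B × Fin n) :=
  {p | (∀ j < p.2, f p.1 j x = 0) ∧ 0 ≤ f p.1 p.2 x}

/-- The set of points having the same lexicographic signs as `x`. -/
def lexCell (f : B → Fin n → E →ₗ[ℝ] ℝ) (x : E) : Set E := {y | lexNonneg f y = lexNonneg f x}

/-- A family of sequences of forms that is closed under negation. -/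
def IsSymmetricFamily (f : B → Fin n → E →ₗ[ℝ] ℝ) : Prop := ∀ b, ∃ b', ∀ i, f b' i = -f b i

variable {f : B → Fin n → E →ₗ[ℝ] ℝ}

theorem mem_lexCell_self (x : E) : x ∈ lexCell f x := rfl

theorem lexNonneg_zero : lexNonneg f 0 = Set.univ := by
  ext p; simp [lexNonneg]

/-- Where the forms of `b` vanish at `y` up to `i`, both `b` and its negative impose a weak
inequality on `x`, which together give an equation. -/
theorem eq_zero_of_forall_nonneg (hf : IsSymmetricFamily f) {x y : E}
    (h : ∀ p ∈ lexNonneg f y, 0 ≤ f p.1 p.2 x) {b : B} {i : Fin n}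
    (hy : ∀ j ≤ i, f b j y = 0) : f b i x = 0 := by
  obtain ⟨b', hb'⟩ := hf b
  have h1 := h (b, i) ⟨fun j hj => hy j hj.le, (hy i le_rfl).ge⟩
  have h2 := h (b', i) ⟨fun j hj => by simp [hb', hy j (le_of_lt hj)], by simp [hb', hy i le_rfl]⟩
  simp only [hb', LinearMap.neg_apply] at h1 h2
  linarith

/-- The vanishing conditions in `lexNonneg` come for free by symmetry, so the inclusion is a system
of weak linear inequalities on `x`. This is what makes closures of cells computable. -/
theorem lexNonneg_subset_iff (hf : IsSymmetricFamily f) {x y : E} :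
    lexNonneg f y ⊆ lexNonneg f x ↔ ∀ p ∈ lexNonneg f y, 0 ≤ f p.1 p.2 x := by
  refine ⟨fun h p hp => (h hp).2, fun h p hp => ⟨fun j hj => ?_, h p hp⟩⟩
  exact eq_zero_of_forall_nonneg hf h fun k hk => hp.1 k (hk.trans_lt hj)

theorem eq_zero_of_lexNonneg_subset (hf : IsSymmetricFamily f) {x y : E}
    (h : lexNonneg f y ⊆ lexNonneg f x) {b : B} {i : Fin n}
    (hy : ∀ j ≤ i, f b j y = 0) : f b i x = 0 :=
  eq_zero_of_forall_nonneg hf ((lexNonneg_subset_iff hf).1 h) hy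

/-- At the first form of a sequence that is non-zero at `y`, the value at `x` weakly has the same
sign; where `y` has only met zeros, so has `x`. So adding a multiple of `x` to a positive multiple
of `y` changes no sign. -/
theorem lexNonneg_smul_add_smul (hf : IsSymmetricFamily f) {x y : E}
    (h : lexNonneg f y ⊆ lexNonneg f x) {s t : ℝ} (hs : 0 ≤ s) (ht : 0 < t) :
    lexNonneg f (s • x + t • y) = lexNonneg f y := by
  have key : ∀ (b : B) (i : Fin n), (∀ j < i, f b j y = 0) → 0 < f b i y →
      0 < f b i (s • x + t • y) := by
    intro b i h0 hi
    have h1 : 0 ≤ f b i x := (h (show (b, i) ∈ lexNonneg f y from ⟨h0, hi.le⟩)).2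
    simp only [map_add, map_smul, smul_eq_mul]
    positivity
  have key' : ∀ (b : B) (i : Fin n), (∀ j < i, f b j y = 0) → f b i y < 0 →
      f b i (s • x + t • y) < 0 := by
    intro b i h0 hi
    obtain ⟨b', hb'⟩ := hf b
    have := key b' i (fun j hj => by simp [hb', h0 j hj]) (by simpa [hb'] using hi)
    rw [hb', LinearMap.neg_apply] at this
    linarith
  apply Set.Subset.antisymm
  · rintro ⟨b, i⟩ ⟨h0, hi⟩
    -- The first form not vanishing at `y` would, by `key` or `key'`, not vanish at the sum either.
    have hz : ∀ j < i, f b j y = 0 := by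
      intro j
      induction j using WellFoundedLT.induction with
      | ind j ih =>
        intro hj
        by_contra hne
        have hk : ∀ k < j, f b k y = 0 := fun k hk => ih k hk (hk.trans hj)
        rcases lt_or_gt_of_ne hne with hlt | hgt
        · exact (key' b j hk hlt).ne (h0 j hj)
        · exact (key b j hk hgt).ne' (h0 j hj)
    exact ⟨hz, not_lt.1 fun hlt => not_lt.2 hi (key' b i hz hlt)⟩
  · rintro ⟨b, i⟩ hp
    have hx := h hp
    refine ⟨fun j hj => ?_, ?_⟩
    · simp [hp.1 j hj, hx.1 j hj]
    · have h1 := hp.2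
      have h2 := hx.2
      simp only [map_add, map_smul, smul_eq_mul] at h1 h2 ⊢
      positivity

theorem lexNonneg_smul (hf : IsSymmetricFamily f) (x : E) {t : ℝ} (ht : 0 < t) :
    lexNonneg f (t • x) = lexNonneg f x := by
  simpa using lexNonneg_smul_add_smul hf (subset_refl (lexNonneg f x)) le_rfl ht

theorem isConic_lexCell (hf : IsSymmetricFamily f) (x : E) : IsConic (lexCell f x) :=
  fun _ ht _ hy => (lexNonneg_smul hf _ ht).trans hy

theorem lexCell_eq_formCone (hf : IsSymmetricFamily f) (y : E) :
    lexCell f y = formCone (fun p : B × Fin n => f p.1 p.2)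
      {p | ∀ j ≤ p.2, f p.1 j y = 0} {p | (∀ j < p.2, f p.1 j y = 0) ∧ 0 < f p.1 p.2 y} := by
  ext x
  constructor
  · intro (hx : lexNonneg f x = lexNonneg f y)
    refine ⟨fun p hp => eq_zero_of_lexNonneg_subset hf hx.ge hp, fun p hp => ?_⟩
    have hpx : p ∈ lexNonneg f x := hx.ge ⟨hp.1, hp.2.le⟩
    refine lt_of_le_of_ne hpx.2 fun h0 => hp.2.ne' ?_
    refine eq_zero_of_lexNonneg_subset hf hx.le fun j hj => ?_
    rcases hj.lt_or_eq with hj | rfl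
    · exact hpx.1 j hj
    · exact h0.symm
  · rintro ⟨h0, h1⟩
    have h1' : ∀ (b : B) (i : Fin n), (∀ j < i, f b j y = 0) → f b i y < 0 → f b i x < 0 := by
      intro b i hz hi
      obtain ⟨b', hb'⟩ := hf b
      have := h1 (b', i) ⟨fun j hj => by simp [hb', hz j hj], by simpa [hb'] using hi⟩
      simp only [hb', LinearMap.neg_apply] at this
      linarith
    apply Set.Subset.antisymm
    · rintro ⟨b, i⟩ ⟨hx0, hxi⟩
      have hz : ∀ j < i, f b j y = 0 := by
        intro j
        induction j using WellFoundedLT.induction with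
        | ind j ih =>
          intro hj
          by_contra hne
          have hk : ∀ k < j, f b k y = 0 := fun k hk => ih k hk (hk.trans hj)
          rcases lt_or_gt_of_ne hne with hlt | hgt
          · exact (h1' b j hk hlt).ne (hx0 j hj)
          · exact (h1 (b, j) ⟨hk, hgt⟩).ne' (hx0 j hj)
      exact ⟨hz, not_lt.1 fun hlt => not_lt.2 hxi (h1' b i hz hlt)⟩
    · rintro ⟨b, i⟩ ⟨hy0, hyi⟩
      refine ⟨fun j hj => h0 (b, j) fun k hk => hy0 k (hk.trans_lt hj), ?_⟩
      rcases hyi.lt_or_eq with hlt | heq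
      · exact (h1 (b, i) ⟨hy0, hlt⟩).le
      · refine (h0 (b, i) fun k hk => ?_).ge
        rcases hk.lt_or_eq with hk | rfl
        · exact hy0 k hk
        · exact heq.symm

end Lex

/-! ### Closures of sign cells and the cell decomposition of the sphere -/

section LexTopology

variable {E : Type*} [NormedAddCommGroup E] [NormedSpace ℝ E]
  {B : Type*} {n : ℕ} {f : B → Fin n → E →ₗ[ℝ] ℝ}

theorem rayOf_mem_raysOf_lexCell (hf : IsSymmetricFamily f) (x : E) (v : {v : E // v ≠ 0}) :
    rayOf v ∈ raysOf (lexCell f x) ↔ lexNonneg f v.1 = lexNonneg f x :=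
  rayOf_mem_raysOf (isConic_lexCell hf x) v

variable [FiniteDimensional ℝ E]

/-- The right-hand side is an intersection of closed half-spaces. Conversely, each of its points `x`
is the limit of `x + ε • y` for `ε → 0`, and these points have the signs of `y`. -/
theorem closure_lexCell (hf : IsSymmetricFamily f) (y : E) :
    closure (lexCell f y) = {x | lexNonneg f y ⊆ lexNonneg f x} := by
  apply Set.Subset.antisymm
  · apply closure_minimal
    · intro x (hx : lexNonneg f x = lexNonneg f y)
      exact hx.ge
    · have : {x | lexNonneg f y ⊆ lexNonneg f x} = ⋂ p ∈ lexNonneg f y, {x | 0 ≤ f p.1 p.2 x} := by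
        ext x
        simp [lexNonneg_subset_iff hf]
      rw [this]
      exact isClosed_biInter fun p _ =>
        isClosed_le continuous_const (LinearMap.continuous_of_finiteDimensional _)
  · intro x hx
    have ht : Filter.Tendsto (fun ε : ℝ => (1 : ℝ) • x + ε • y) (nhdsWithin 0 (Set.Ioi 0))
        (nhds ((1 : ℝ) • x + (0 : ℝ) • y)) :=
      ((continuous_const.add (continuous_id.smul continuous_const)).tendsto 0).mono_left
        nhdsWithin_le_nhds
    rw [one_smul, zero_smul, add_zero] at ht
    refine mem_closure_of_tendsto ht ?_
    filter_upwards [self_mem_nhdsWithin] with ε hε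
    have := lexNonneg_smul_add_smul hf hx zero_le_one hε
    rwa [one_smul] at this

theorem isConic_closure_lexCell (hf : IsSymmetricFamily f) (x : E) :
    IsConic (closure (lexCell f x)) := by
  rw [closure_lexCell hf]
  exact fun t ht y hy => hy.trans (lexNonneg_smul hf y ht).ge

theorem rayOf_mem_closure_raysOf_lexCell (hf : IsSymmetricFamily f) (x : E)
    (v : {v : E // v ≠ 0}) :
    rayOf v ∈ closure (raysOf (lexCell f x)) ↔ lexNonneg f x ⊆ lexNonneg f v.1 := by
  rw [closure_raysOf (isConic_closure_lexCell hf x),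
    rayOf_mem_raysOf (isConic_closure_lexCell hf x), closure_lexCell hf]
  rfl

theorem closure_raysOf_lexCell_subset_iff (hf : IsSymmetricFamily f) {x : E} (hx : x ≠ 0) (y : E) :
    closure (raysOf (lexCell f x)) ⊆ closure (raysOf (lexCell f y)) ↔
      lexNonneg f y ⊆ lexNonneg f x := by
  constructor
  · intro h
    exact (rayOf_mem_closure_raysOf_lexCell hf y ⟨x, hx⟩).1
      (h ((rayOf_mem_closure_raysOf_lexCell hf x ⟨x, hx⟩).2 subset_rfl))
  · intro h r hr
    obtain ⟨v, rfl⟩ := rayOf_surjective r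
    rw [rayOf_mem_closure_raysOf_lexCell hf] at hr ⊢
    exact h.trans hr

/-- The sets of rays of the lexicographic cells of the non-zero vectors. -/
def rayCells (f : B → Fin n → E →ₗ[ℝ] ℝ) : Set (Set (RaySpace E)) :=
  {c | ∃ x, x ≠ 0 ∧ c = raysOf (lexCell f x)}

/-- Partition and boundary are read off from the sign sets: the boundary of a cell consists of the
cells with strictly larger sign set. Separation of points guarantees the positive form that the ball
criterion needs. -/
theorem isRegularCellDecomposition_rayCells [Finite B] (hf : IsSymmetricFamily f)
    (hsep : ∀ x, (∀ b i, f b i x = 0) → x = 0) : IsRegularCellDecomposition (rayCells f) where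
  t2 := inferInstance
  finite := by
    refine (Set.finite_range fun S : Set (B × Fin n) =>
      (raysOf {y : E | lexNonneg f y = S} : Set (RaySpace E))).subset ?_
    rintro _ ⟨x, -, rfl⟩
    exact ⟨lexNonneg f x, rfl⟩
  pairwiseDisjoint := by
    rintro _ ⟨x, -, rfl⟩ _ ⟨y, -, rfl⟩ hne
    refine Set.disjoint_left.2 fun r hx hy => hne ?_
    obtain ⟨v, rfl⟩ := rayOf_surjective r
    have h1 := (rayOf_mem_raysOf_lexCell hf x v).1 hx
    have h2 := (rayOf_mem_raysOf_lexCell hf y v).1 hy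
    simp only [lexCell, ← h1, ← h2]
  sUnion_eq := by
    refine Set.eq_univ_of_forall fun r => ?_
    obtain ⟨v, rfl⟩ := rayOf_surjective r
    exact ⟨_, ⟨v.1, v.2, rfl⟩, (rayOf_mem_raysOf_lexCell hf _ v).2 rfl⟩
  isBall := by
    rintro _ ⟨x, hx, rfl⟩
    -- Otherwise no sequence has a first non-zero form at `x`, a negative value being turned
    -- positive by the negated sequence, and then `x = 0` by separation.
    have hne : {p : B × Fin n | (∀ j < p.2, f p.1 j x = 0) ∧ 0 < f p.1 p.2 x}.Nonempty := by
      by_contra! hemp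
      refine hx (hsep x fun b i => ?_)
      induction i using WellFoundedLT.induction with
      | ind i ih =>
        by_contra hi
        rcases lt_or_gt_of_ne hi with hlt | hgt
        · obtain ⟨b', hb'⟩ := hf b
          exact hemp.subset (show (b', i) ∈ _ from
            ⟨fun j hj => by simp [hb', ih j hj], by simpa [hb'] using hlt⟩)
        · exact hemp.subset (show (b, i) ∈ _ from ⟨ih, hgt⟩)
    have h := mem_lexCell_self (f := f) x
    rw [lexCell_eq_formCone hf] at h ⊢
    exact isOpenBallCell_raysOf_formCone _ _ _ (Set.toFinite _) hne ⟨x, h⟩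
  boundary := by
    rintro _ ⟨x, hx, rfl⟩
    refine ⟨{c | ∃ y, y ≠ 0 ∧ c = raysOf (lexCell f y) ∧ lexNonneg f x ⊂ lexNonneg f y},
      fun c ⟨y, hy, hc, _⟩ => ⟨y, hy, hc⟩, ?_⟩
    ext r
    obtain ⟨v, rfl⟩ := rayOf_surjective r
    rw [Set.mem_sdiff, rayOf_mem_closure_raysOf_lexCell hf, rayOf_mem_raysOf_lexCell hf]
    simp only [Set.mem_iUnion, exists_prop]
    constructor
    · rintro ⟨h1, h2⟩
      exact ⟨_, ⟨v.1, v.2, rfl, h1.ssubset_of_ne (Ne.symm h2)⟩,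
        (rayOf_mem_closure_raysOf_lexCell hf _ v).2 subset_rfl⟩
    · rintro ⟨_, ⟨y, -, rfl, hxy⟩, hv⟩
      have h := hxy.trans_subset ((rayOf_mem_closure_raysOf_lexCell hf y v).1 hv)
      exact ⟨h.subset, h.ne'⟩

/-- Stated for an abstract `P` with chosen representatives `a`, so that it serves both for the
strata and for their indices, whose representatives are first projected to the span of the simple
roots. -/
theorem exists_orderIso_facePoset_rayCells (hf : IsSymmetricFamily f)
    (hsep : ∀ x, (∀ b i, f b i x = 0) → x = 0) {P : Type*} [Preorder P] (a : P → E)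
    (hle : ∀ p q, p ≤ q ↔ lexNonneg f (a q) ⊆ lexNonneg f (a p))
    (hanti : ∀ p q : P, p ≤ q → q ≤ p → p = q) (hsurj : ∀ x, ∃ p, lexNonneg f (a p) = lexNonneg f x)
    (p₀ : P) (hp₀ : lexNonneg f (a p₀) = Set.univ) :
    ∃ e : {p : P // p ≠ p₀} ≃o FacePoset (rayCells f),
      ∀ p, (e p : Set (RaySpace E)) = closure (raysOf (lexCell f (a p.1))) := by
  have hinj : ∀ p q, lexNonneg f (a p) = lexNonneg f (a q) → p = q := fun p q h =>
    hanti p q ((hle p q).2 h.ge) ((hle q p).2 h.le)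
  have hne : ∀ p, p ≠ p₀ → a p ≠ 0 := fun p hp h => hp (hinj p p₀ (by rw [h, hp₀, lexNonneg_zero]))
  let g : {p : P // p ≠ p₀} → FacePoset (rayCells f) := fun p =>
    ⟨closure (raysOf (lexCell f (a p.1))), _, ⟨a p.1, hne _ p.2, rfl⟩, rfl⟩
  have hg : ∀ p q, g p ≤ g q ↔ p ≤ q := fun p q =>
    (closure_raysOf_lexCell_subset_iff hf (hne _ p.2) _).trans (hle p.1 q.1).symm
  have hbij : Function.Bijective g := by
    constructor
    · intro p q h
      exact Subtype.ext (hanti _ _ ((hg p q).1 h.le) ((hg q p).1 h.ge))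
    · rintro ⟨_, _, ⟨x, hx, rfl⟩, rfl⟩
      obtain ⟨p, hp⟩ := hsurj x
      refine ⟨⟨p, ?_⟩, Subtype.ext ?_⟩
      · rintro rfl
        rw [hp₀] at hp
        -- A point with the full sign set is a common zero of all forms, so only `0` belongs to
        -- `p₀`.
        refine hx (hsep x fun b i => ?_)
        refine eq_zero_of_lexNonneg_subset (y := 0) hf ?_ fun j _ => map_zero _
        rw [← hp]
        exact Set.subset_univ _
      · simp only [g, lexCell, hp]
  exact ⟨⟨Equiv.ofBijective g hbij, fun {p q} => hg p q⟩, fun p => rfl⟩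

end LexTopology

/-! ### Transport of cell decompositions along homeomorphisms -/

section Transport

variable {T T' : Type*} [TopologicalSpace T] [TopologicalSpace T']

theorem IsRegularCellDecomposition.image {E : Set (Set T)} (hE : IsRegularCellDecomposition E)
    (φ : T ≃ₜ T') : IsRegularCellDecomposition (Set.image φ '' E) where
  t2 := by
    have := hE.t2
    exact φ.t2Space
  finite := hE.finite.image _
  pairwiseDisjoint := by
    rintro _ ⟨e, he, rfl⟩ _ ⟨e', he', rfl⟩ hne
    exact (Set.disjoint_image_iff φ.injective).2
      (hE.pairwiseDisjoint he he' fun h => hne (by rw [h]))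
  sUnion_eq := by
    rw [← Set.image_sUnion, hE.sUnion_eq, Set.image_univ, φ.surjective.range_eq]
  isBall := by
    rintro _ ⟨e, he, rfl⟩
    obtain ⟨k, h, hh⟩ := hE.isBall e he
    refine ⟨k, (h.trans (φ.image (closure e))).trans
      (Homeomorph.setCongr (φ.image_closure e)), ?_⟩
    conv_rhs => rw [← hh, Set.image_image]
    rfl
  boundary := by
    rintro _ ⟨e, he, rfl⟩
    obtain ⟨A, hA, h⟩ := hE.boundary e he
    refine ⟨Set.image φ '' A, Set.image_mono hA, ?_⟩
    rw [← φ.image_closure, ← Set.image_sdiff φ.injective, h, Set.image_iUnion₂, Set.biUnion_image]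
    simp only [φ.image_closure]

/-- The face poset is invariant under homeomorphisms. -/
def facePosetImage (E : Set (Set T)) (φ : T ≃ₜ T') :
    FacePoset E ≃o FacePoset (Set.image φ '' E) where
  toFun c := ⟨φ '' c.1, by
    obtain ⟨e, he, hc⟩ := c.2
    exact ⟨φ '' e, ⟨e, he, rfl⟩, by rw [hc, φ.image_closure]⟩⟩
  invFun c := ⟨φ ⁻¹' c.1, by
    obtain ⟨_, ⟨e, he, rfl⟩, hc⟩ := c.2
    exact ⟨e, he, by rw [hc, ← φ.image_closure, φ.injective.preimage_image]⟩⟩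
  left_inv c := Subtype.ext (φ.injective.preimage_image _)
  right_inv c := Subtype.ext (φ.surjective.image_preimage _)
  map_rel_iff' := Set.image_subset_image_iff φ.injective

end Transport

/-! ### Gradedness from a rank function -/

section Graded

variable {P : Type*} [Preorder P]

/-- Below every element of rank greater than `m` and above every given smaller element of rank
at most `m`, there is an element of rank `m`. -/
theorem exists_between_of_rank (ρ : P → ℕ)
    (hρ : ∀ a b : P, a < b → ∃ c, a ≤ c ∧ c < b ∧ ρ c + 1 = ρ b)
    (hanti : ∀ a b : P, a ≤ b → b ≤ a → a = b) {a b : P} (hab : a ≤ b) {m : ℕ} (ha : ρ a ≤ m)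
    (hb : m ≤ ρ b) : ∃ c, a ≤ c ∧ c ≤ b ∧ ρ c = m := by
  induction h : ρ b - m generalizing b with
  | zero => exact ⟨b, hab, le_rfl, by omega⟩
  | succ k ih =>
    have hlt : a < b := lt_of_le_not_ge hab fun hba => by
      have := hanti a b hab hba
      subst this
      omega
    obtain ⟨c, hac, hcb, hc⟩ := hρ a b hlt
    obtain ⟨d, had, hdc, hd⟩ := ih hac (by omega) (by omega)
    exact ⟨d, had, hdc.trans hcb.le, hd⟩

theorem rank_lt_of_lt (ρ : P → ℕ)
    (hρ : ∀ a b : P, a < b → ∃ c, a ≤ c ∧ c < b ∧ ρ c + 1 = ρ b)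
    (hanti : ∀ a b : P, a ≤ b → b ≤ a → a = b) {a b : P} (hab : a < b) : ρ a < ρ b := by
  induction h : ρ b generalizing b with
  | zero =>
    obtain ⟨c, -, -, hc⟩ := hρ a b hab
    omega
  | succ k ih =>
    obtain ⟨c, hac, -, hc⟩ := hρ a b hab
    by_cases hca : c ≤ a
    · rw [hanti a c hac hca]
      omega
    · have := ih (lt_of_le_not_ge hac hca) (by omega)
      omega

/-- The rank is injective on a chain, and a maximal chain attains every value up to the rank of the
top: a missing value could be filled in by an interpolated element comparable with the whole chain.
-/
theorem isGradedPoset_of_rank (hanti : ∀ a b : P, a ≤ b → b ≤ a → a = b) {bot top : P}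
    (hbot : IsBot bot) (htop : IsTop top) (ρ : P → ℕ) (hρ0 : ρ bot = 0)
    (hρ : ∀ a b : P, a < b → ∃ c, a ≤ c ∧ c < b ∧ ρ c + 1 = ρ b) : IsGradedPoset P := by
  have hlt : ∀ {a b : P}, a < b → ρ a < ρ b := rank_lt_of_lt ρ hρ hanti
  have hmono : ∀ {a b : P}, a ≤ b → ρ a ≤ ρ b := fun {a b} hab => by
    by_cases hba : b ≤ a
    · rw [hanti a b hab hba]
    · exact (hlt (lt_of_le_not_ge hab hba)).le
  suffices key : ∀ C : Set P, IsMaxChain (· ≤ ·) C → C.encard = (Set.Iic (ρ top)).encard from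
    ⟨hanti, ⟨bot, hbot⟩, ⟨top, htop⟩, fun C D hC hD => (key C hC).trans (key D hD).symm⟩
  intro C hC
  have hmem : ∀ c : P, (∀ d ∈ C, d ≤ c ∨ c ≤ d) → c ∈ C := fun c hc => by
    have := hC.2 (hC.1.insert fun d hd _ => (hc d hd).symm) (Set.subset_insert c C)
    rw [this]
    exact Set.mem_insert c C
  have hle : ∀ a ∈ C, ∀ b ∈ C, ρ a ≤ ρ b → a ≤ b := by
    intro a ha b hb hab
    by_cases h : a = b
    · rw [h]
    · rcases hC.1 ha hb h with h' | h'
      · exact h'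
      · by_contra hn
        exact absurd (hlt (lt_of_le_not_ge h' hn)) (not_lt.2 hab)
  have hinj : Set.InjOn ρ C := fun a ha b hb hab =>
    hanti a b (hle a ha b hb hab.le) (hle b hb a ha hab.ge)
  have himage : ρ '' C = Set.Iic (ρ top) := by
    apply Set.Subset.antisymm
    · rintro _ ⟨c, -, rfl⟩
      exact hmono (htop c)
    · intro m hm
      by_contra hmC
      have hmC' : ∀ c ∈ C, ρ c ≠ m := fun c hc h => hmC ⟨c, hc, h⟩
      have hbotC : bot ∈ C := hmem bot fun d _ => Or.inr (hbot d)
      have htopC : top ∈ C := hmem top fun d _ => Or.inl (htop d)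
      let Lo := {c | c ∈ C ∧ ρ c ≤ m}
      let Hi := {c | c ∈ C ∧ m ≤ ρ c}
      have hLofin : (ρ '' Lo).Finite := (Set.finite_Iic m).subset (by
        rintro _ ⟨c, hc, rfl⟩; exact hc.2)
      -- `a` and `b` are the chain elements next to the gap at rank `m`. An element of rank `m`
      -- between them is comparable with the entire chain.
      obtain ⟨_, ⟨a, ha, rfl⟩, hamax⟩ := hLofin.exists_maximal
        ⟨_, bot, ⟨hbotC, by omega⟩, rfl⟩
      obtain ⟨b, hb, hbmin⟩ : ∃ b ∈ Hi, ∀ c ∈ Hi, ρ b ≤ ρ c := by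
        have hne : (ρ '' Hi).Nonempty := ⟨_, top, ⟨htopC, hm⟩, rfl⟩
        obtain ⟨b, hb, hbe⟩ := Nat.sInf_mem hne
        exact ⟨b, hb, fun c hc => hbe ▸ Nat.sInf_le ⟨c, hc, rfl⟩⟩
      obtain ⟨c, hac, hcb, hc⟩ := exists_between_of_rank ρ hρ hanti
        (hle a ha.1 b hb.1 (ha.2.trans hb.2)) ha.2 hb.2
      refine hmC' c (hmem c fun d hd => ?_) hc
      rcases le_total (ρ d) m with h | h
      · left
        refine (hle d hd a ha.1 ?_).trans hac
        by_contra hn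
        exact hn (hamax ⟨d, ⟨hd, h⟩, rfl⟩ (not_le.1 hn).le)
      · right
        exact hcb.trans (hle b hb.1 d hd (hbmin d ⟨hd, h⟩))
  rw [← himage, hinj.encard_image]

/-- Adjoining a maximum to a poset whose elements all lie below an element of rank `N`. -/
theorem isGradedPoset_withTop (hanti : ∀ a b : P, a ≤ b → b ≤ a → a = b) {bot : P}
    (hbot : IsBot bot) (ρ : P → ℕ) (hρ0 : ρ bot = 0)
    (hρ : ∀ a b : P, a < b → ∃ c, a ≤ c ∧ c < b ∧ ρ c + 1 = ρ b) (N : ℕ)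
    (hN : ∀ a : P, ∃ b, a ≤ b ∧ ρ b = N) : IsGradedPoset (WithTop P) := by
  refine isGradedPoset_of_rank (bot := (bot : WithTop P)) (top := ⊤) ?_ ?_ (fun _ => le_top)
    -- The new maximum has rank `N + 1`, one above the elements of rank `N` provided by `hN`.
    (fun a => WithTop.recTopCoe (C := fun _ => ℕ) (N + 1) ρ a) hρ0 ?_
  · intro a b hab hba
    induction a using WithTop.recTopCoe with
    | top =>
      induction b using WithTop.recTopCoe with
      | top => rfl
      | coe b => exact absurd hab (WithTop.not_top_le_coe b)
    | coe a =>
      induction b using WithTop.recTopCoe with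
      | top => exact absurd hba (WithTop.not_top_le_coe a)
      | coe b =>
        rw [hanti a b (WithTop.coe_le_coe.1 hab) (WithTop.coe_le_coe.1 hba)]
  · intro a
    induction a using WithTop.recTopCoe with
    | top => exact le_top
    | coe a => exact WithTop.coe_le_coe.2 (hbot a)
  · intro a b hab
    induction a using WithTop.recTopCoe with
    | top => exact absurd hab not_top_lt
    | coe a =>
      induction b using WithTop.recTopCoe with
      | top =>
        obtain ⟨c, hac, hc⟩ := hN a
        exact ⟨c, WithTop.coe_le_coe.2 hac, WithTop.coe_lt_top c, congrArg (· + 1) hc⟩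
      | coe b =>
        obtain ⟨c, hac, hcb, hc⟩ := hρ a b (WithTop.coe_lt_coe.1 hab)
        exact ⟨c, WithTop.coe_le_coe.2 hac, WithTop.coe_lt_coe.2 hcb, hc⟩

end Graded

/-! ### Root systems, simple systems and the reflection group -/

section Roots

variable {V : Type*} [NormedAddCommGroup V] [InnerProductSpace ℝ V]

theorem rootRefl_apply (α v : V) :
    rootRefl α v = v - (2 * (inner ℝ α v / ‖α‖ ^ 2)) • α := by
  rw [rootRefl, Submodule.reflection_orthogonal_apply, Submodule.reflection_singleton_apply]
  simp only [RCLike.ofReal_real_eq_id, id_eq, two_smul, two_mul, add_smul]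
  abel

theorem rootRefl_self (α : V) : rootRefl α α = -α :=
  Submodule.reflection_orthogonalComplement_singleton_eq_neg α

theorem rootRefl_rootRefl (α v : V) : rootRefl α (rootRefl α v) = v :=
  Submodule.reflection_reflection _ v

theorem rootRefl_mul_self (α : V) : rootRefl α * rootRefl α = 1 :=
  LinearIsometryEquiv.ext fun v => rootRefl_rootRefl α v

theorem rootRefl_eq_self {α v : V} (h : inner ℝ α v = 0) : rootRefl α v = v := by
  simp [rootRefl_apply, h]

theorem inner_map_left (w : V ≃ₗᵢ[ℝ] V) (x y : V) :
    inner ℝ (w x) y = inner ℝ x (w⁻¹ y) := by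
  rw [← w.inner_map_map x (w⁻¹ y)]
  exact congrArg _ (w.apply_symm_apply y).symm

theorem rootRefl_map (w : V ≃ₗᵢ[ℝ] V) (α : V) : rootRefl (w α) = w * rootRefl α * w⁻¹ := by
  ext v
  change _ = w (rootRefl α (w⁻¹ v))
  rw [rootRefl_apply, rootRefl_apply, inner_map_left, w.norm_map, map_sub, map_smul]
  congr 1
  exact (w.apply_symm_apply v).symm

theorem mem_span_nnreal_imp {Δ : Set V} {β : V} (h : β ∈ Submodule.span ℝ≥0 Δ) :
    β ∈ Submodule.span ℝ Δ :=
  Submodule.span_le_restrictScalars ℝ≥0 ℝ Δ h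

theorem inner_nonneg_of_mem_span {Δ : Set V} {v : V} (hv : ∀ α ∈ Δ, 0 ≤ inner ℝ α v) {β : V}
    (hβ : β ∈ Submodule.span ℝ≥0 Δ) : 0 ≤ inner ℝ β v := by
  induction hβ using Submodule.span_induction with
  | mem x h => exact hv x h
  | zero => simp
  | add x y _ _ hx hy => rw [inner_add_left]; exact add_nonneg hx hy
  | smul a x _ hx =>
    rw [NNReal.smul_def, real_inner_smul_left]
    exact mul_nonneg a.2 hx

theorem inner_eq_zero_of_mem_span {Δ : Set V} {v : V} (hv : ∀ α ∈ Δ, inner ℝ α v = 0) {β : V}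
    (hβ : β ∈ Submodule.span ℝ≥0 Δ) : inner ℝ β v = 0 := by
  refine le_antisymm ?_ (inner_nonneg_of_mem_span (fun α hα => (hv α hα).ge) hβ)
  have := inner_nonneg_of_mem_span (v := -v) (fun α hα => by simp [hv α hα]) hβ
  simpa using this

/-- A non-negative combination orthogonal to `v ∈ C_{I,J}` only involves elements of `J`. -/
theorem mem_span_of_inner_eq_zero {I J : Set V} {v : V} (hv : v ∈ facetCone I J) {β : V}
    (hβ : β ∈ Submodule.span ℝ≥0 I) (h : inner ℝ β v = 0) : β ∈ Submodule.span ℝ≥0 J := by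
  have hv' : ∀ α ∈ I, 0 ≤ inner ℝ α v := fun α hα => by
    by_cases hJ : α ∈ J
    · exact (hv.1 α hJ).ge
    · exact (hv.2 α ⟨hα, hJ⟩).le
  induction hβ using Submodule.span_induction with
  | mem x hx =>
    by_contra hn
    exact (hv.2 x ⟨hx, fun hJ => hn (Submodule.subset_span hJ)⟩).ne' h
  | zero => exact zero_mem _
  | add x y hx hy ihx ihy =>
    rw [inner_add_left] at h
    have h1 := inner_nonneg_of_mem_span hv' hx
    have h2 := inner_nonneg_of_mem_span hv' hy
    exact add_mem (ihx (by linarith)) (ihy (by linarith))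
  | smul a x hx ih =>
    rw [NNReal.smul_def, real_inner_smul_left] at h
    rcases mul_eq_zero.1 h with ha | hx0
    · have : a = 0 := by exact_mod_cast ha
      rw [this, zero_smul]
      exact zero_mem _
    · exact Submodule.smul_mem _ _ (ih hx0)

/-- Linear independence allows any values on the simple roots. The value `1` gives a strictly
dominant vector; values `0` and `1` give points of prescribed facets. -/
theorem exists_inner_eq [FiniteDimensional ℝ V] {Δ : Set V} (h : LinearIndepOn ℝ id Δ)
    (g : V → ℝ) : ∃ v : V, ∀ α ∈ Δ, inner ℝ α v = g α := by
  let b := Module.Basis.extend h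
  let f : V →ₗ[ℝ] ℝ := b.constr ℝ fun x => g x
  let v := (InnerProductSpace.toDual ℝ V).symm (LinearMap.toContinuousLinearMap f)
  refine ⟨v, fun α hα => ?_⟩
  have h1 : inner ℝ v α = f α := InnerProductSpace.toDual_symm_apply
  rw [real_inner_comm, h1]
  have h2 : b ⟨α, Module.Basis.subset_extend h hα⟩ = α := Module.Basis.extend_apply_self h _
  conv_lhs => rw [← h2]
  exact b.constr_basis ℝ _ _

variable {Φ Δ : Set V}

theorem IsRootSystem.ne_zero (hΦ : IsRootSystem Φ) {β : V} (hβ : β ∈ Φ) : β ≠ 0 :=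
  fun h => hΦ.zero_notMem (h ▸ hβ)

theorem IsRootSystem.neg_mem (hΦ : IsRootSystem Φ) {β : V} (hβ : β ∈ Φ) : -β ∈ Φ :=
  rootRefl_self β ▸ hΦ.refl_mem β hβ β hβ

theorem IsRootSystem.map_mem_iff (hΦ : IsRootSystem Φ) {w : V ≃ₗᵢ[ℝ] V} (hw : w ∈ weylGroup Φ)
    (β : V) : w β ∈ Φ ↔ β ∈ Φ := by
  induction hw using Subgroup.closure_induction generalizing β with
  | mem x hx =>
    obtain ⟨α, hα, rfl⟩ := hx
    refine ⟨fun h => ?_, hΦ.refl_mem α hα β⟩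
    rw [← rootRefl_rootRefl α β]
    exact hΦ.refl_mem α hα _ h
  | one => rfl
  | mul x y _ _ hx hy => exact (hx _).trans (hy _)
  | inv x _ hx =>
    rw [← hx (x⁻¹ β)]
    exact iff_of_eq (congrArg (· ∈ Φ) (x.apply_symm_apply β))

theorem map_word_mem {l : List V} (hl : ∀ α ∈ l, α ∈ Φ) : (l.map rootRefl).prod ∈ weylGroup Φ := by
  refine Subgroup.list_prod_mem _ fun w hw => ?_
  obtain ⟨α, hα, rfl⟩ := List.mem_map.1 hw
  exact Subgroup.subset_closure (Set.mem_image_of_mem _ (hl α hα))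

theorem sub_mem_span_of_mem_weylGroup {w : V ≃ₗᵢ[ℝ] V} (hw : w ∈ weylGroup Φ) (v : V) :
    w v - v ∈ Submodule.span ℝ Φ := by
  induction hw using Subgroup.closure_induction generalizing v with
  | mem x hx =>
    obtain ⟨α, hα, rfl⟩ := hx
    rw [rootRefl_apply, sub_sub_cancel_left]
    exact neg_mem (Submodule.smul_mem _ _ (Submodule.subset_span hα))
  | one => simp
  | mul x y _ _ hx hy =>
    have := add_mem (hx (y v)) (hy v)
    rwa [sub_add_sub_cancel] at this
  | inv x _ hx =>
    have := neg_mem (hx (x⁻¹ v))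
    rw [neg_sub] at this
    have h : x (x⁻¹ v) = v := x.apply_symm_apply v
    rwa [h] at this

/-- For `w` fixing all roots, `w v - v` is orthogonal to the span of the roots, but it also lies in
this span because `w` is a product of reflections. Hence `W` is faithful on the roots, even if they
do not span `V`. -/
theorem eq_one_of_forall_root {w : V ≃ₗᵢ[ℝ] V} (hw : w ∈ weylGroup Φ)
    (h : ∀ β ∈ Φ, w β = β) : w = 1 := by
  ext v
  have h1 : ∀ y ∈ Submodule.span ℝ Φ, inner ℝ y (w v - v) = 0 := by
    intro y hy
    induction hy using Submodule.span_induction with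
    | mem x hx =>
      have h2 := w.inner_map_map x v
      rw [h x hx] at h2
      rw [inner_sub_right, h2, sub_self]
    | zero => simp
    | add x y _ _ hx hy => rw [inner_add_left, hx, hy, add_zero]
    | smul a x _ hx => rw [real_inner_smul_left, hx, mul_zero]
  exact sub_eq_zero.1 (inner_self_eq_zero.1 (h1 _ (sub_mem_span_of_mem_weylGroup hw v)))

theorem finite_weylGroup (hΦ : IsRootSystem Φ) : Finite (weylGroup Φ) := by
  have := hΦ.finite.to_subtype
  refine Finite.of_injective (fun w : weylGroup Φ => fun β : Φ =>
    (⟨w.1 β.1, (hΦ.map_mem_iff w.2 β.1).2 β.2⟩ : Φ)) fun w w' h => ?_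
  have h1 : w'.1⁻¹ * w.1 = 1 := by
    refine eq_one_of_forall_root (mul_mem (inv_mem w'.2) w.2) fun β hβ => ?_
    have h2 : w.1 β = w'.1 β := congrArg Subtype.val (congrFun h ⟨β, hβ⟩)
    change w'.1⁻¹ (w.1 β) = β
    rw [h2]
    exact w'.1.symm_apply_apply β
  exact Subtype.ext (inv_mul_eq_one.1 h1).symm

theorem IsSimpleSystem.posRoot_or_neg (hΔ : IsSimpleSystem Φ Δ) {β : V} (hβ : β ∈ Φ) :
    β ∈ posRoots Φ Δ ∨ -β ∈ posRoots Φ Δ := by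
  rw [← hΔ.union_eq] at hβ
  exact hβ

theorem IsSimpleSystem.not_posRoot_neg (hΔ : IsSimpleSystem Φ Δ) {β : V}
    (hβ : β ∈ posRoots Φ Δ) : -β ∉ posRoots Φ Δ :=
  fun h => Set.disjoint_left.1 hΔ.disjoint hβ h

theorem IsSimpleSystem.mem_posRoots (hΔ : IsSimpleSystem Φ Δ) {α : V} (hα : α ∈ Δ) :
    α ∈ posRoots Φ Δ :=
  ⟨hΔ.subset hα, Submodule.subset_span hα⟩

/-- A negative root pairs non-positively with `ρ`, and pairing `0` would make it a combination of no
simple roots. -/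
theorem posRoot_of_inner_nonneg (hΦ : IsRootSystem Φ) (hΔ : IsSimpleSystem Φ Δ) {ρ : V}
    (hρ : ∀ α ∈ Δ, 0 < inner ℝ α ρ) {β : V} (hβ : β ∈ Φ) (h : 0 ≤ inner ℝ β ρ) :
    β ∈ posRoots Φ Δ := by
  refine (hΔ.posRoot_or_neg hβ).resolve_right fun hn => hΦ.ne_zero (hΦ.neg_mem hβ) ?_
  have h1 := inner_nonneg_of_mem_span (fun α hα => (hρ α hα).le) hn.2
  rw [inner_neg_left] at h1
  have h2 : -β ∈ Submodule.span ℝ≥0 (∅ : Set V) :=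
    mem_span_of_inner_eq_zero ⟨by simp, fun α hα => hρ α hα.1⟩ hn.2
      (by rw [inner_neg_left]; linarith)
  simpa using h2

variable [FiniteDimensional ℝ V]

/-- Every tuple of vectors is conjugate to one that is lexicographically dominant. -/
theorem exists_lex_dominant (hΦ : IsRootSystem Φ) (hΔ : IsSimpleSystem Φ Δ) {m : ℕ}
    (x : Fin m → V) : ∃ w ∈ weylGroup Φ, ∀ α ∈ Δ, ∀ i, (∀ j < i, inner ℝ α (w (x j)) = 0) →
      0 ≤ inner ℝ α (w (x i)) := by
  obtain ⟨ρ, hρ⟩ := exists_inner_eq hΔ.linearIndep fun _ => 1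
  have := finite_weylGroup hΦ
  -- Over the finite group, the tuple of pairings with `ρ` is maximised lexicographically. A simple
  -- root violating dominance at `i` would fix the earlier components and increase the `i`-th
  -- pairing.
  obtain ⟨w, hw⟩ := Finite.exists_max fun w : weylGroup Φ =>
    toLex fun i : Fin m => (inner ℝ ρ (w.1 (x i)) : ℝ)
  refine ⟨w.1, w.2, fun α hα i h0 => ?_⟩
  by_contra! hlt
  let s : weylGroup Φ :=
    ⟨rootRefl α, Subgroup.subset_closure (Set.mem_image_of_mem _ (hΔ.subset hα))⟩
  refine not_lt.2 (hw (s * w)) ⟨i, fun j hj => ?_, ?_⟩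
  · change inner ℝ ρ (w.1 (x j)) = inner ℝ ρ (rootRefl α (w.1 (x j)))
    rw [rootRefl_eq_self (h0 j hj)]
  · change inner ℝ ρ (w.1 (x i)) < inner ℝ ρ (rootRefl α (w.1 (x i)))
    have hn : 0 < ‖α‖ ^ 2 := by
      have := norm_pos_iff.2 (hΦ.ne_zero (hΔ.subset hα))
      positivity
    rw [rootRefl_apply, inner_sub_right, real_inner_smul_right, real_inner_comm α ρ, hρ α hα]
    have := div_neg_of_neg_of_pos hlt hn
    linarith

/-- Reflecting in `α` changes only the coefficient of `α`. If the result is negative, all other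
coefficients vanish, so `β` is a non-negative multiple of `α` and equals `α` by reducedness. -/
theorem rootRefl_mem_posRoots (hΦ : IsRootSystem Φ) (hΔ : IsSimpleSystem Φ Δ) {α β : V}
    (hα : α ∈ Δ) (hβ : β ∈ posRoots Φ Δ) (hne : β ≠ α) : rootRefl α β ∈ posRoots Φ Δ := by
  classical
  refine (hΔ.posRoot_or_neg (hΦ.refl_mem α (hΔ.subset hα) β hβ.1)).resolve_right fun hn => ?_
  -- Pairing with `v` sums the coefficients of the simple roots other than `α`.
  obtain ⟨v, hv⟩ := exists_inner_eq hΔ.linearIndep fun γ => if γ = α then 0 else 1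
  have hvα : inner ℝ α v = 0 := by simpa using hv α hα
  have hv0 : ∀ γ ∈ Δ, 0 ≤ inner ℝ γ v := fun γ hγ => by
    rw [hv γ hγ]; split_ifs <;> norm_num
  have h1 := inner_nonneg_of_mem_span hv0 hn.2
  have h2 := inner_nonneg_of_mem_span hv0 hβ.2
  rw [inner_neg_left, rootRefl_apply, inner_sub_left, real_inner_smul_left, hvα] at h1
  have h3 : β ∈ Submodule.span ℝ≥0 {α} := by
    refine mem_span_of_inner_eq_zero (I := Δ) ⟨by simpa using hvα, fun γ hγ => ?_⟩ hβ.2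
      (by linarith)
    rw [hv γ hγ.1, if_neg (show γ ≠ α from hγ.2)]
    exact one_pos
  obtain ⟨c, rfl⟩ := Submodule.mem_span_singleton.1 h3
  rcases hΦ.reduced α (hΔ.subset hα) c hβ.1 with hc | hc
  · have : c = 1 := by exact_mod_cast hc
    exact hne (by rw [this, one_smul])
  · have h4 : (0 : ℝ) ≤ (c : ℝ) := c.2
    have h5 : (c : ℝ) = -1 := hc
    linarith

/-- Among the positive roots conjugate to `β` under simple reflections, one of least height `⟪γ, ρ⟫`
is simple: otherwise a simple reflection would lower it. So `rootRefl β` is conjugate to a simple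
reflection. -/
theorem weylGroup_eq_closure_simple (hΦ : IsRootSystem Φ) (hΔ : IsSimpleSystem Φ Δ) :
    weylGroup Φ = Subgroup.closure (rootRefl '' Δ) := by
  apply le_antisymm
  · refine (Subgroup.closure_le _).2 ?_
    suffices h : ∀ β ∈ posRoots Φ Δ, rootRefl β ∈ Subgroup.closure (rootRefl '' Δ) by
      rintro _ ⟨β, hβ, rfl⟩
      rcases hΔ.posRoot_or_neg hβ with hp | hn
      · exact h β hp
      · have : rootRefl (-β) = rootRefl β := by
          ext v; simp [rootRefl_apply, neg_div, sub_eq_add_neg]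
        exact this ▸ h _ hn
    intro β hβ
    obtain ⟨ρ, hρ⟩ := exists_inner_eq hΔ.linearIndep fun _ => 1
    let O : Set V := {γ ∈ posRoots Φ Δ | ∃ w ∈ Subgroup.closure (rootRefl '' Δ), γ = w β}
    have hO : O.Finite := hΦ.finite.subset fun γ hγ => hγ.1.1
    obtain ⟨γ, ⟨hγ, w, hw, hγw⟩, hmin⟩ := Set.exists_min_image O (fun γ => (inner ℝ γ ρ : ℝ)) hO
      ⟨β, hβ, 1, one_mem _, rfl⟩
    obtain ⟨α, hα, hαγ⟩ : ∃ α ∈ Δ, 0 < inner ℝ α γ := by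
      by_contra! hcon
      have := inner_nonneg_of_mem_span (v := -γ) (fun α hα => by
        rw [inner_neg_right]; linarith [hcon α hα]) hγ.2
      rw [inner_neg_right] at this
      exact hΦ.ne_zero hγ.1 (inner_self_eq_zero.1 (le_antisymm (by linarith) real_inner_self_nonneg))
    have hs : rootRefl α ∈ Subgroup.closure (rootRefl '' Δ) :=
      Subgroup.subset_closure (Set.mem_image_of_mem _ hα)
    have hγα : γ = α := by
      by_contra hne
      have h1 := hmin (rootRefl α γ) ⟨rootRefl_mem_posRoots hΦ hΔ hα hγ hne, rootRefl α * w,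
        mul_mem hs hw, by rw [hγw]; rfl⟩
      have hn : 0 < ‖α‖ ^ 2 := by
        have := norm_pos_iff.2 (hΦ.ne_zero (hΔ.subset hα))
        positivity
      simp only [rootRefl_apply α γ, inner_sub_left, real_inner_smul_left, hρ α hα] at h1
      have := div_pos hαγ hn
      linarith
    have h2 : rootRefl β = w⁻¹ * rootRefl α * w := by
      rw [← hγα, hγw, rootRefl_map]
      group
    rw [h2]
    exact mul_mem (mul_mem (inv_mem hw) hs) hw
  · exact Subgroup.closure_mono (Set.image_mono hΔ.subset)

theorem exists_word (hΦ : IsRootSystem Φ) (hΔ : IsSimpleSystem Φ Δ) {w : V ≃ₗᵢ[ℝ] V}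
    (hw : w ∈ weylGroup Φ) : ∃ l : List V, (∀ α ∈ l, α ∈ Δ) ∧ (l.map rootRefl).prod = w := by
  rw [weylGroup_eq_closure_simple hΦ hΔ] at hw
  induction hw using Subgroup.closure_induction with
  | mem x hx =>
    obtain ⟨α, hα, rfl⟩ := hx
    exact ⟨[α], by simpa using hα, by simp⟩
  | one => exact ⟨[], by simp, by simp⟩
  | mul x y _ _ hx hy =>
    obtain ⟨l, hl, rfl⟩ := hx
    obtain ⟨l', hl', rfl⟩ := hy
    refine ⟨l ++ l', fun α hα => ?_, by simp⟩
    rcases List.mem_append.1 hα with h | h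
    · exact hl α h
    · exact hl' α h
  | inv x _ hx =>
    obtain ⟨l, hl, rfl⟩ := hx
    refine ⟨l.reverse, fun α hα => hl α (List.mem_reverse.1 hα), ?_⟩
    rw [List.prod_inv_reverse, List.map_map, List.map_reverse]
    congr 2

/-- The exchange condition. -/
theorem exists_shorter_word (hΦ : IsRootSystem Φ) (hΔ : IsSimpleSystem Φ Δ) {α : V} (hα : α ∈ Δ)
    (l : List V) (hl : ∀ β ∈ l, β ∈ Δ) (h : -((l.map rootRefl).prod α) ∈ posRoots Φ Δ) :
    ∃ l' : List V, (∀ β ∈ l', β ∈ Δ) ∧ l'.length < l.length ∧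
      (l'.map rootRefl).prod = (l.map rootRefl).prod * rootRefl α := by
  induction l with
  | nil => exact absurd h (hΔ.not_posRoot_neg (hΔ.mem_posRoots hα))
  | cons β l ih =>
    have hβ : β ∈ Δ := hl β List.mem_cons_self
    have hl1 : ∀ γ ∈ l, γ ∈ Δ := fun γ hγ => hl γ (List.mem_cons_of_mem _ hγ)
    set w := (l.map rootRefl).prod with hw
    have hwα : w α ∈ Φ :=
      (hΦ.map_mem_iff (map_word_mem fun γ hγ => hΔ.subset (hl1 γ hγ)) α).2 (hΔ.subset hα)
    rw [List.map_cons, List.prod_cons, ← hw] at h ⊢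
    rcases hΔ.posRoot_or_neg hwα with hp | hn
    · have hwαβ : w α = β := by
        by_contra hne
        exact hΔ.not_posRoot_neg (rootRefl_mem_posRoots hΦ hΔ hβ hp hne) h
      refine ⟨l, hl1, by simp, ?_⟩
      rw [← hw, ← hwαβ, rootRefl_map, inv_mul_cancel_right, mul_assoc, rootRefl_mul_self, mul_one]
    · obtain ⟨l', hl', hlen, hprod⟩ := ih hl1 hn
      refine ⟨β :: l', fun γ hγ => ?_, by simpa using hlen, ?_⟩
      · rcases List.mem_cons.1 hγ with rfl | h
        · exact hβ
        · exact hl' γ h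
      · rw [List.map_cons, List.prod_cons, hprod, mul_assoc]

/-- The last letter `α` of a non-empty word is sent to a positive root, so the word without that
letter makes `α` negative. The exchange condition then gives a shorter word for the same element. -/
theorem word_eq_one (hΦ : IsRootSystem Φ) (hΔ : IsSimpleSystem Φ Δ) (l : List V)
    (hl : ∀ β ∈ l, β ∈ Δ) (h : ∀ α ∈ Δ, (l.map rootRefl).prod α ∈ posRoots Φ Δ) :
    (l.map rootRefl).prod = 1 := by
  induction hk : l.length using Nat.strong_induction_on generalizing l with
  | _ k ih =>
    rcases List.eq_nil_or_concat l with rfl | ⟨l₁, α, rfl⟩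
    · simp
    · rw [List.concat_eq_append] at *
      have hα : α ∈ Δ := hl α (by simp)
      have hprod : ((l₁ ++ [α]).map rootRefl).prod = (l₁.map rootRefl).prod * rootRefl α := by simp
      have hneg := h α hα
      rw [hprod] at hneg
      change (l₁.map rootRefl).prod (rootRefl α α) ∈ _ at hneg
      rw [rootRefl_self, map_neg] at hneg
      obtain ⟨l', hl', hlen, hprod'⟩ := exists_shorter_word hΦ hΔ hα l₁
        (fun β hβ => hl β (List.mem_append_left _ hβ)) hneg
      rw [hprod, ← hprod']
      refine ih l'.length ?_ l' hl' ?_ rfl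
      · rw [← hk, List.length_append]
        omega
      · intro γ hγ
        rw [hprod', ← hprod]
        exact h γ hγ

/-- An element of the Weyl group that preserves positivity of roots is trivial. -/
theorem eq_one_of_forall_posRoot (hΦ : IsRootSystem Φ) (hΔ : IsSimpleSystem Φ Δ)
    {w : V ≃ₗᵢ[ℝ] V} (hw : w ∈ weylGroup Φ) (h : ∀ α ∈ Δ, w α ∈ posRoots Φ Δ) : w = 1 := by
  obtain ⟨l, hl, rfl⟩ := exists_word hΦ hΔ hw
  exact word_eq_one hΦ hΔ l hl h

end Roots

/-! ### Elementary facts on flags -/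

section Flags

variable {V : Type*} {Δ : Set V} {n : ℕ}

theorem flags_subset {I : Fin (n + 1) → Set V} (hI : I ∈ flags Δ n) (k : Fin (n + 1)) : I k ⊆ Δ :=
  hI.1 ▸ hI.2 (Fin.zero_le k)

theorem flags_succ_subset {I : Fin (n + 1) → Set V} (hI : I ∈ flags Δ n) (i : Fin n) :
    I i.succ ⊆ I i.castSucc :=
  hI.2 (Fin.castSucc_lt_succ).le

end Flags

/-! ### Strata as lexicographic sign cells of the roots -/

section Strata

variable {V : Type*} [NormedAddCommGroup V] [InnerProductSpace ℝ V] {Φ Δ : Set V} {n : ℕ}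

/-- The linear forms `x ↦ ⟪β, x i⟫` on `Vⁿ`. -/
def rootForm (Φ : Set V) (n : ℕ) (β : Φ) (i : Fin n) : (Fin n → V) →ₗ[ℝ] ℝ :=
  (innerₗ V β.1).comp (LinearMap.proj i)

@[simp] theorem rootForm_apply (β : Φ) (i : Fin n) (x : Fin n → V) :
    rootForm Φ n β i x = inner ℝ β.1 (x i) := rfl

/-- The lexicographic signs of the roots on a tuple of vectors. -/
abbrev rootSigns (Φ : Set V) (x : Fin n → V) : Set (Φ × Fin n) := lexNonneg (rootForm Φ n) x

theorem mem_rootSigns {x : Fin n → V} {β : Φ} {i : Fin n} :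
    (β, i) ∈ rootSigns Φ x ↔ (∀ j < i, inner ℝ β.1 (x j) = 0) ∧ 0 ≤ inner ℝ β.1 (x i) := Iff.rfl

theorem isSymmetricFamily_rootForm (hΦ : IsRootSystem Φ) (n : ℕ) :
    IsSymmetricFamily (rootForm Φ n) := fun β =>
  ⟨⟨-β.1, hΦ.neg_mem β.2⟩, fun i => by ext x; simp [rootForm]⟩

/-- The group permutes the roots, so acting on tuples only relabels the signs. -/
theorem rootSigns_map_subset_iff (hΦ : IsRootSystem Φ) {w : V ≃ₗᵢ[ℝ] V} (hw : w ∈ weylGroup Φ)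
    (x y : Fin n → V) :
    (rootSigns Φ fun i => w (y i)) ⊆ (rootSigns Φ fun i => w (x i)) ↔
      rootSigns Φ y ⊆ rootSigns Φ x := by
  have key : ∀ {w : V ≃ₗᵢ[ℝ] V}, w ∈ weylGroup Φ → ∀ x y : Fin n → V,
      rootSigns Φ y ⊆ rootSigns Φ x →
      (rootSigns Φ fun i => w (y i)) ⊆ (rootSigns Φ fun i => w (x i)) := by
    rintro w hw x y h ⟨β, i⟩ hβ
    have h1 : ∀ v, inner ℝ β.1 (w v) = inner ℝ (w⁻¹ β.1) v := fun v => by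
      rw [inner_map_left, inv_inv]
    simp only [mem_rootSigns, h1] at hβ ⊢
    exact h (show ((⟨w⁻¹ β.1, (hΦ.map_mem_iff (inv_mem hw) _).2 β.2⟩ : Φ), i) ∈ _ from hβ)
  refine ⟨fun h => ?_, key hw x y⟩
  have h1 := key (inv_mem hw) _ _ h
  have h2 : ∀ v, w⁻¹ (w v) = v := w.symm_apply_apply
  simpa only [h2] using h1

theorem rootSigns_map_eq_iff (hΦ : IsRootSystem Φ) {w : V ≃ₗᵢ[ℝ] V} (hw : w ∈ weylGroup Φ)
    (x y : Fin n → V) :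
    (rootSigns Φ fun i => w (y i)) = (rootSigns Φ fun i => w (x i)) ↔
      rootSigns Φ y = rootSigns Φ x := by
  rw [Set.Subset.antisymm_iff, Set.Subset.antisymm_iff, rootSigns_map_subset_iff hΦ hw,
    rootSigns_map_subset_iff hΦ hw]

theorem inner_nonneg_of_mem_stdStratum {I : Fin (n + 1) → Set V} {x : Fin n → V}
    (hx : x ∈ stdStratum I) (i : Fin n) {β : V} (hβ : β ∈ Submodule.span ℝ≥0 (I i.castSucc)) :
    0 ≤ inner ℝ β (x i) := by
  refine inner_nonneg_of_mem_span (fun α hα => ?_) hβ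
  by_cases h : α ∈ I i.succ
  · exact ((hx i).1 α h).ge
  · exact ((hx i).2 α ⟨hα, h⟩).le

/-- On a standard stratum every root in the cone of `I i.castSucc` is non-negative on `x i`, and it
vanishes there only if it involves no simple root outside `I i.succ`. This turns vanishing along
coordinates into membership in the cones of the flag. -/
theorem forall_inner_eq_zero_iff {I : Fin (n + 1) → Set V} (hI : I ∈ flags Δ n) {x : Fin n → V}
    (hx : x ∈ stdStratum I) {β : V} (hβ : β ∈ posRoots Φ Δ) (k : Fin (n + 1)) :
    (∀ j : Fin n, j.castSucc < k → inner ℝ β (x j) = 0) ↔ β ∈ Submodule.span ℝ≥0 (I k) := by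
  induction k using Fin.induction with
  | zero => simpa [hI.1] using hβ.2
  | succ i ih =>
    constructor
    · intro h
      have h1 := ih.1 fun j hj => h j (hj.trans Fin.castSucc_lt_succ)
      exact mem_span_of_inner_eq_zero (hx i) h1 (h i Fin.castSucc_lt_succ)
    · intro h j hj
      rcases (Fin.le_castSucc_iff.2 hj).lt_or_eq with hj | hj
      · exact ih.2 (Submodule.span_mono (flags_succ_subset hI i) h) j hj
      · obtain rfl := Fin.castSucc_injective n hj
        exact inner_eq_zero_of_mem_span (hx j).1 h

/-- A larger flag means more equations, hence a smaller face. With `I = I'` it shows that the signs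
are constant on a standard stratum. -/
theorem rootSigns_subset_of_flags_le (hΔ : IsSimpleSystem Φ Δ)
    {I I' : Fin (n + 1) → Set V} (hI : I ∈ flags Δ n) (hI' : I' ∈ flags Δ n) (h : ∀ k, I k ⊆ I' k)
    {x x' : Fin n → V} (hx : x ∈ stdStratum I) (hx' : x' ∈ stdStratum I') :
    rootSigns Φ x ⊆ rootSigns Φ x' := by
  rintro ⟨⟨β, hβ⟩, i⟩ hp
  obtain ⟨h0, hi⟩ := mem_rootSigns.1 hp
  rcases hΔ.posRoot_or_neg hβ with hpos | hneg
  · have h1 := (forall_inner_eq_zero_iff hI hx hpos i.castSucc).1 fun j hj => h0 j hj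
    have h2 := Submodule.span_mono (h _) h1
    exact ⟨fun j hj => (forall_inner_eq_zero_iff hI' hx' hpos i.castSucc).2 h2 j hj,
      inner_nonneg_of_mem_stdStratum hx' i h2⟩
  -- For a negative root, non-negativity at `x i` forces vanishing there, so `-β` descends to the
  -- next member of the flag.
  · have h1 := (forall_inner_eq_zero_iff hI hx hneg i.castSucc).1 fun j hj => by
      rw [inner_neg_left, neg_eq_zero]; exact h0 j hj
    have h2 := inner_nonneg_of_mem_stdStratum hx i h1
    rw [inner_neg_left] at h2
    have h3 : inner ℝ (-β) (x i) = 0 := by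
      rw [inner_neg_left]
      have : 0 ≤ inner ℝ β (x i) := hi
      linarith
    have h4 := (forall_inner_eq_zero_iff hI' hx' hneg i.succ).2
      (Submodule.span_mono (h _) (mem_span_of_inner_eq_zero (hx i) h1 h3))
    simp only [inner_neg_left, neg_eq_zero] at h4
    exact ⟨fun j hj => h4 j ((Fin.castSucc_lt_castSucc_iff.2 hj).trans Fin.castSucc_lt_succ), (h4 i Fin.castSucc_lt_succ).ge⟩

/-- The conditions on simple roots that define the stratum are among those cutting out the cell of
`x`; the reverse inclusion is the constancy of signs. -/
theorem stdStratum_eq_lexCell (hΦ : IsRootSystem Φ) (hΔ : IsSimpleSystem Φ Δ)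
    {I : Fin (n + 1) → Set V} (hI : I ∈ flags Δ n) {x : Fin n → V} (hx : x ∈ stdStratum I) :
    stdStratum I = lexCell (rootForm Φ n) x := by
  apply Set.Subset.antisymm
  · intro y hy
    exact Set.Subset.antisymm (rootSigns_subset_of_flags_le hΔ hI hI (fun _ => subset_rfl) hy hx)
      (rootSigns_subset_of_flags_le hΔ hI hI (fun _ => subset_rfl) hx hy)
  · rw [lexCell_eq_formCone (isSymmetricFamily_rootForm hΦ n)]
    rintro y ⟨h0, h1⟩ i
    constructor
    · intro α hα
      refine h0 (⟨α, hΔ.subset (flags_subset hI _ hα)⟩, i) fun j hj => ?_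
      exact (hx j).1 α (hI.2 (Fin.succ_le_succ_iff.2 hj) hα)
    · intro α hα
      refine h1 (⟨α, hΔ.subset (flags_subset hI _ hα.1)⟩, i) ⟨fun j hj => ?_, (hx i).2 α hα⟩
      exact (hx j).1 α (hI.2 (Fin.succ_le_castSucc_iff.2 hj) hα.1)

theorem translate_eq_lexCell (hΦ : IsRootSystem Φ) (hΔ : IsSimpleSystem Φ Δ)
    {I : Fin (n + 1) → Set V} (hI : I ∈ flags Δ n) {w : V ≃ₗᵢ[ℝ] V} (hw : w ∈ weylGroup Φ)
    {x : Fin n → V} (hx : x ∈ translate w I) : translate w I = lexCell (rootForm Φ n) x := by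
  obtain ⟨x, hx, rfl⟩ := hx
  rw [translate, stdStratum_eq_lexCell hΦ hΔ hI hx]
  apply Set.Subset.antisymm
  · rintro _ ⟨y, hy, rfl⟩
    exact (rootSigns_map_eq_iff hΦ hw x y).2 hy
  · intro y hy
    have h : (fun i => w (w⁻¹ (y i))) = y := funext fun i => w.apply_symm_apply (y i)
    refine ⟨fun i => w⁻¹ (y i), (rootSigns_map_eq_iff hΦ hw _ _).1 ?_, h⟩
    rw [h]
    exact hy

theorem eq_of_mem_stdStratum {I I' : Fin (n + 1) → Set V} (hI : I ∈ flags Δ n)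
    (hI' : I' ∈ flags Δ n) {x : Fin n → V} (hx : x ∈ stdStratum I) (hx' : x ∈ stdStratum I') :
    I = I' := by
  funext k
  induction k using Fin.induction with
  | zero => rw [hI.1, hI'.1]
  | succ i ih =>
    have key : ∀ {I : Fin (n + 1) → Set V}, I ∈ flags Δ n → x ∈ stdStratum I →
        I i.succ = {α ∈ I i.castSucc | inner ℝ α (x i) = 0} := by
      intro I hI hx
      ext α
      refine ⟨fun h => ⟨flags_succ_subset hI i h, (hx i).1 α h⟩, fun h => ?_⟩
      by_contra hn
      exact ((hx i).2 α ⟨h.1, hn⟩).ne' h.2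
    rw [key hI hx, key hI' hx', ih]

/-- A point lying in two translated strata with the same carrier determines the index. -/
theorem StratumIndex.eq_of_mem [FiniteDimensional ℝ V] (hΦ : IsRootSystem Φ)
    (hΔ : IsSimpleSystem Φ Δ) {p q : StratumIndex Φ Δ n} {x : Fin n → V}
    (hp : x ∈ translate p.w p.I) (hq : x ∈ translate q.w q.I) : p = q := by
  obtain ⟨w, I, hw, hI, hmaps⟩ := p
  obtain ⟨w', I', hw', hI', hmaps'⟩ := q
  obtain ⟨x, hx, rfl⟩ := hp
  obtain ⟨x', hx', hxx'⟩ := hq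
  have hxx : ∀ i, x' i = (w'⁻¹ * w) (x i) := fun i => by
    have h := congrArg (fun v => w'⁻¹ v) (congrFun hxx' i)
    exact (w'.symm_apply_apply (x' i)).symm.trans h
  have hu : w'⁻¹ * w ∈ weylGroup Φ := mul_mem (inv_mem hw') hw
  have hspan : ∀ {w : V ≃ₗᵢ[ℝ] V} {J : Set V}, (∀ α ∈ J, w α ∈ posRoots Φ Δ) →
      ∀ β ∈ Submodule.span ℝ≥0 J, w β ∈ Submodule.span ℝ≥0 Δ := by
    intro w J h β hβ
    induction hβ using Submodule.span_induction with
    | mem α hα => exact (h α hα).2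
    | zero => simp
    | add y z _ _ hy hz => rw [map_add]; exact add_mem hy hz
    | smul a y _ hy =>
      have : w (a • y) = a • w y := map_smul w (a : ℝ) y
      rw [this]
      exact Submodule.smul_mem _ _ hy
  -- If this element made a simple `α` negative, then `α` would be lexicographically non-negative on
  -- `x` and non-positive as seen from `x'`, so it would vanish on all components. Then `α` and its
  -- negated image lie in the cones of the last flag members, and the two `mapsTo` conditions make
  -- both `w α` and `-w α` positive.
  have hone : w'⁻¹ * w = 1 := by
    refine eq_one_of_forall_posRoot hΦ hΔ hu fun α hα => ?_
    have hαΦ := (hΦ.map_mem_iff hu α).2 (hΔ.subset hα)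
    refine (hΔ.posRoot_or_neg hαΦ).resolve_right fun hneg => ?_
    have hαpos := hΔ.mem_posRoots hα
    have hinner : ∀ i, inner ℝ (-((w'⁻¹ * w) α)) (x' i) = -inner ℝ α (x i) := fun i => by
      rw [hxx, inner_neg_left, LinearIsometryEquiv.inner_map_map]
    have hzero : ∀ i, inner ℝ α (x i) = 0 := by
      intro i
      induction i using WellFoundedLT.induction with
      | ind i ih =>
        have h1 := inner_nonneg_of_mem_stdStratum hx i
          ((forall_inner_eq_zero_iff hI hx hαpos i.castSucc).1 fun j hj => ih j hj)
        have h2 := inner_nonneg_of_mem_stdStratum hx' i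
          ((forall_inner_eq_zero_iff hI' hx' hneg i.castSucc).1 fun j hj => by
            rw [hinner, ih j hj, neg_zero])
        rw [hinner] at h2
        linarith
    have h1 := (forall_inner_eq_zero_iff hI hx hαpos (Fin.last n)).1 fun j _ => hzero j
    have h2 := (forall_inner_eq_zero_iff hI' hx' hneg (Fin.last n)).1 fun j _ => by
      rw [hinner, hzero, neg_zero]
    have h3 := hspan hmaps _ h1
    have h4 := hspan hmaps' _ h2
    have h5 : w' (-((w'⁻¹ * w) α)) = -(w α) := by
      rw [map_neg]
      exact congrArg _ (w'.apply_symm_apply (w α))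
    rw [h5] at h4
    have h6 := (hΦ.map_mem_iff hw α).2 (hΔ.subset hα)
    exact hΔ.not_posRoot_neg ⟨h6, h3⟩ ⟨hΦ.neg_mem h6, h4⟩
  obtain rfl : w' = w := inv_mul_eq_one.1 hone
  have : x' = x := funext fun i => by rw [hxx, hone]; rfl
  subst this
  obtain rfl := eq_of_mem_stdStratum hI hI' hx hx'
  rfl

/-- The translated strata cover `Vⁿ`. -/
theorem StratumIndex.exists_mem [FiniteDimensional ℝ V] (hΦ : IsRootSystem Φ)
    (hΔ : IsSimpleSystem Φ Δ) (x : Fin n → V) :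
    ∃ p : StratumIndex Φ Δ n, x ∈ translate p.w p.I := by
  obtain ⟨ρ, hρ⟩ := exists_inner_eq hΔ.linearIndep fun _ => 1
  -- The strictly dominant `ρ` is appended as a last component to break ties: a simple `α` vanishing
  -- on all `u (x i)` satisfies `⟪u⁻¹ α, ρ⟫ ≥ 0`, so `u⁻¹ α` is positive, as the index requires.
  obtain ⟨u, hu, hdom⟩ := exists_lex_dominant hΦ hΔ (Fin.snoc x ρ : Fin (n + 1) → V)
  have hdomx : ∀ α ∈ Δ, ∀ i : Fin n, (∀ j < i, inner ℝ α (u (x j)) = 0) →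
      0 ≤ inner ℝ α (u (x i)) := by
    intro α hα i h
    have h1 := hdom α hα i.castSucc fun j hj => by
      obtain ⟨j, rfl⟩ := Fin.exists_castSucc_eq.2 (hj.trans_le (Fin.le_last _)).ne
      rw [Fin.snoc_castSucc]
      exact h j hj
    rwa [Fin.snoc_castSucc] at h1
  let I : Fin (n + 1) → Set V := fun k =>
    {α ∈ Δ | ∀ j : Fin n, j.castSucc < k → inner ℝ α (u (x j)) = 0}
  have hI : I ∈ flags Δ n := by
    refine ⟨?_, fun k l hkl α hα => ⟨hα.1, fun j hj => hα.2 j (hj.trans_le hkl)⟩⟩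
    ext α
    simp [I]
  have hinv : ∀ v, u⁻¹ (u v) = v := u.symm_apply_apply
  refine ⟨⟨u⁻¹, I, inv_mem hu, hI, fun α hα => ?_⟩, fun i => u (x i), fun i => ⟨?_, ?_⟩,
    funext fun i => hinv _⟩
  · refine posRoot_of_inner_nonneg hΦ hΔ (ρ := ρ) (fun α hα => by rw [hρ α hα]; exact one_pos)
      ((hΦ.map_mem_iff (inv_mem hu) α).2 (hΔ.subset hα.1)) ?_
    rw [inner_map_left, inv_inv]
    have h1 := hdom α hα.1 (Fin.last n) fun j hj => by
      obtain ⟨j, rfl⟩ := Fin.exists_castSucc_eq.2 hj.ne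
      rw [Fin.snoc_castSucc]
      exact hα.2 j hj
    rwa [Fin.snoc_last] at h1
  · exact fun α hα => hα.2 i Fin.castSucc_lt_succ
  · rintro α ⟨hα, hn⟩
    refine lt_of_le_of_ne (hdomx α hα.1 i fun j hj => hα.2 j hj) fun h0 => hn ⟨hα.1, fun j hj => ?_⟩
    rcases (Fin.le_castSucc_iff.2 hj).lt_or_eq with hj | hj
    · exact hα.2 j hj
    · obtain rfl := Fin.castSucc_injective n hj
      exact h0.symm

theorem stdStratum_nonempty [FiniteDimensional ℝ V] (hΔ : IsSimpleSystem Φ Δ)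
    {I : Fin (n + 1) → Set V} (hI : I ∈ flags Δ n) : (stdStratum I).Nonempty := by
  classical
  choose v hv using fun i : Fin n =>
    exists_inner_eq hΔ.linearIndep fun α => if α ∈ I i.succ then 0 else 1
  refine ⟨v, fun i => ⟨fun α hα => ?_, fun α hα => ?_⟩⟩
  · rw [hv i α (flags_subset hI _ hα), if_pos hα]
  · rw [hv i α (flags_subset hI _ hα.1), if_neg hα.2]
    exact one_pos

theorem Stratum.carrier_eq_lexCell (hΦ : IsRootSystem Φ) (hΔ : IsSimpleSystem Φ Δ)
    (F : Stratum Φ Δ n) {x : Fin n → V} (hx : x ∈ F.carrier) :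
    F.carrier = lexCell (rootForm Φ n) x := by
  obtain ⟨w, hw, I, hI, h⟩ := F.exists_eq
  rw [h] at hx ⊢
  exact translate_eq_lexCell hΦ hΔ hI hw hx

theorem Stratum.ext_carrier {F G : Stratum Φ Δ n} (h : F.carrier = G.carrier) : F = G := by
  cases F
  cases G
  simpa using h

theorem Stratum.zero_mem_zero : (0 : Fin n → V) ∈ (Stratum.zero Φ Δ n).carrier :=
  ⟨0, fun i => ⟨by simp, by simp⟩, by funext i; simp⟩

variable [FiniteDimensional ℝ V]

theorem Stratum.carrier_nonempty (hΔ : IsSimpleSystem Φ Δ) (F : Stratum Φ Δ n) :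
    F.carrier.Nonempty := by
  obtain ⟨w, -, I, hI, h⟩ := F.exists_eq
  rw [h]
  exact (stdStratum_nonempty hΔ hI).image _

/-- Any representatives will do; from here on the order is handled through sign sets. -/
theorem Stratum.le_iff (hΦ : IsRootSystem Φ) (hΔ : IsSimpleSystem Φ Δ)
    {F G : Stratum Φ Δ n} {x y : Fin n → V} (hx : x ∈ F.carrier) (hy : y ∈ G.carrier) :
    F ≤ G ↔ rootSigns Φ y ⊆ rootSigns Φ x := by
  change closure F.carrier ⊆ closure G.carrier ↔ _
  have hf := isSymmetricFamily_rootForm hΦ n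
  rw [F.carrier_eq_lexCell hΦ hΔ hx, G.carrier_eq_lexCell hΦ hΔ hy, closure_lexCell hf,
    closure_lexCell hf]
  exact ⟨fun h => h (subset_refl (rootSigns Φ x)), fun h z hz => h.trans hz⟩

theorem Stratum.antisymm (hΦ : IsRootSystem Φ) (hΔ : IsSimpleSystem Φ Δ) (F G : Stratum Φ Δ n)
    (h : F ≤ G) (h' : G ≤ F) : F = G := by
  obtain ⟨x, hx⟩ := F.carrier_nonempty hΔ
  obtain ⟨y, hy⟩ := G.carrier_nonempty hΔ
  apply Stratum.ext_carrier
  have hxy : rootSigns Φ x = rootSigns Φ y :=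
    Set.Subset.antisymm ((Stratum.le_iff hΦ hΔ hy hx).1 h') ((Stratum.le_iff hΦ hΔ hx hy).1 h)
  rw [F.carrier_eq_lexCell hΦ hΔ hx, G.carrier_eq_lexCell hΦ hΔ hy, lexCell, lexCell]
  simp only [hxy]

theorem Stratum.isBot_zero (hΦ : IsRootSystem Φ) (hΔ : IsSimpleSystem Φ Δ) :
    IsBot (Stratum.zero Φ Δ n) := by
  intro F
  obtain ⟨x, hx⟩ := F.carrier_nonempty hΔ
  rw [Stratum.le_iff hΦ hΔ Stratum.zero_mem_zero hx, rootSigns, rootSigns, lexNonneg_zero]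
  exact Set.subset_univ _

theorem toStratum_bijective (hΦ : IsRootSystem Φ) (hΔ : IsSimpleSystem Φ Δ) :
    Function.Bijective (StratumIndex.toStratum : StratumIndex Φ Δ n → Stratum Φ Δ n) := by
  constructor
  · intro p q h
    obtain ⟨x, hx⟩ := p.toStratum.carrier_nonempty hΔ
    exact StratumIndex.eq_of_mem hΦ hΔ hx (h ▸ hx : x ∈ q.toStratum.carrier)
  · intro F
    obtain ⟨x, hx⟩ := F.carrier_nonempty hΔ
    obtain ⟨p, hp⟩ := StratumIndex.exists_mem hΦ hΔ x
    refine ⟨p, Stratum.ext_carrier ?_⟩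
    rw [F.carrier_eq_lexCell hΦ hΔ hx]
    exact p.toStratum.carrier_eq_lexCell hΦ hΔ hp

theorem Stratum.exists_mem (hΦ : IsRootSystem Φ) (hΔ : IsSimpleSystem Φ Δ) (x : Fin n → V) :
    ∃ F : Stratum Φ Δ n, x ∈ F.carrier := by
  obtain ⟨p, hp⟩ := StratumIndex.exists_mem hΦ hΔ x
  exact ⟨p.toStratum, hp⟩

theorem finite_stratum (hΦ : IsRootSystem Φ) (hΔ : IsSimpleSystem Φ Δ) :
    Finite (Stratum Φ Δ n) := by
  have := hΦ.finite.to_subtype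
  choose a ha using fun F : Stratum Φ Δ n => F.carrier_nonempty hΔ
  refine Finite.of_injective (fun F => rootSigns Φ (a F)) fun F G h => ?_
  exact Stratum.antisymm hΦ hΔ F G ((Stratum.le_iff hΦ hΔ (ha F) (ha G)).2 h.ge)
    ((Stratum.le_iff hΦ hΔ (ha G) (ha F)).2 h.le)

end Strata

/-! ### Enlarging one member of a flag -/

section Flags

variable {V : Type*} {Δ : Set V} {n : ℕ}

/-- Adding an element of `I i` to `I (i + 1)`. -/
theorem update_mem_flags {I : Fin (n + 1) → Set V} (hI : I ∈ flags Δ n) {i : Fin n} {α : V}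
    (hα : α ∈ I i.castSucc) :
    Function.update I i.succ (insert α (I i.succ)) ∈ flags Δ n := by
  constructor
  · rw [Function.update_of_ne (Fin.succ_ne_zero i).symm, hI.1]
  · intro a b hab
    by_cases hb : b = i.succ
    · subst hb
      rw [Function.update_self]
      rcases hab.lt_or_eq with hlt | rfl
      · rw [Function.update_of_ne hlt.ne]
        exact Set.insert_subset (hI.2 (Fin.le_castSucc_iff.2 hlt) hα) (hI.2 hab)
      · rw [Function.update_self]
    · rw [Function.update_of_ne hb]
      by_cases ha : a = i.succ
      · subst ha
        rw [Function.update_self]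
        exact (hI.2 hab).trans (Set.subset_insert _ _)
      · rw [Function.update_of_ne ha]
        exact hI.2 hab

theorem subset_update (I : Fin (n + 1) → Set V) (i : Fin n) (α : V) (k : Fin (n + 1)) :
    I k ⊆ Function.update I i.succ (insert α (I i.succ)) k := by
  by_cases hk : k = i.succ
  · subst hk
    rw [Function.update_self]
    exact Set.subset_insert _ _
  · rw [Function.update_of_ne hk]

end Flags

/-! ### The rank of a stratum and the existence of facets -/

section Rank

variable {V : Type*} [NormedAddCommGroup V] [InnerProductSpace ℝ V] {Φ Δ : Set V} {n : ℕ}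

/-- The roots that vanish on the first components of `x`, up to the `i`-th one. -/
def zeroRoots (Φ : Set V) (x : Fin n → V) (i : Fin n) : Set V :=
  {β ∈ Φ | ∀ j ≤ i, inner ℝ β (x j) = 0}

/-- The rank of the stratum of `x`: its dimension modulo the tuples orthogonal to all roots. -/
def strataRank (Φ Δ : Set V) (x : Fin n → V) : ℕ :=
  ∑ i, (Δ.ncard - Module.finrank ℝ (Submodule.span ℝ (zeroRoots Φ x i)))

theorem zeroRoots_mono (hΦ : IsRootSystem Φ) {x y : Fin n → V}
    (h : rootSigns Φ y ⊆ rootSigns Φ x) (i : Fin n) : zeroRoots Φ y i ⊆ zeroRoots Φ x i :=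
  fun β hβ => ⟨hβ.1, fun j hj =>
    eq_zero_of_lexNonneg_subset (isSymmetricFamily_rootForm hΦ n) h (b := ⟨β, hβ.1⟩) (i := j)
      fun k hk => hβ.2 k (hk.trans hj)⟩

theorem zeroRoots_map (hΦ : IsRootSystem Φ) {w : V ≃ₗᵢ[ℝ] V} (hw : w ∈ weylGroup Φ)
    (x : Fin n → V) (i : Fin n) :
    zeroRoots Φ (fun i => w (x i)) i = w '' zeroRoots Φ x i := by
  ext β
  constructor
  · rintro ⟨hβ, h⟩
    refine ⟨w⁻¹ β, ⟨(hΦ.map_mem_iff (inv_mem hw) β).2 hβ, fun j hj => ?_⟩, w.apply_symm_apply β⟩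
    rw [inner_map_left, inv_inv]
    exact h j hj
  · rintro ⟨β, ⟨hβ, h⟩, rfl⟩
    exact ⟨(hΦ.map_mem_iff hw β).2 hβ, fun j hj => by
      rw [LinearIsometryEquiv.inner_map_map]; exact h j hj⟩

theorem strataRank_map (hΦ : IsRootSystem Φ) {w : V ≃ₗᵢ[ℝ] V} (hw : w ∈ weylGroup Φ)
    (x : Fin n → V) : strataRank Φ Δ (fun i => w (x i)) = strataRank Φ Δ x := by
  refine Finset.sum_congr rfl fun i _ => ?_
  have h : Submodule.span ℝ (w '' zeroRoots Φ x i) =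
      (Submodule.span ℝ (zeroRoots Φ x i)).map w.toLinearEquiv.toLinearMap :=
    (Submodule.map_span w.toLinearEquiv.toLinearMap _).symm
  rw [zeroRoots_map hΦ hw, h]
  congr 1
  exact LinearEquiv.finrank_map_eq w.toLinearEquiv _

theorem mem_zeroRoots_iff (hΔ : IsSimpleSystem Φ Δ) {I : Fin (n + 1) → Set V}
    (hI : I ∈ flags Δ n) {x : Fin n → V} (hx : x ∈ stdStratum I) {β : V} (hβ : β ∈ Φ) (i : Fin n) :
    β ∈ zeroRoots Φ x i ↔
      β ∈ Submodule.span ℝ≥0 (I i.succ) ∨ -β ∈ Submodule.span ℝ≥0 (I i.succ) := by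
  have h1 : β ∈ zeroRoots Φ x i ↔ ∀ j : Fin n, j.castSucc < i.succ → inner ℝ β (x j) = 0 := by
    simp only [zeroRoots, Set.mem_sep_iff, hβ, true_and, Fin.castSucc_lt_succ_iff]
  rw [h1]
  constructor
  · intro h
    rcases hΔ.posRoot_or_neg hβ with hp | hn
    · exact Or.inl ((forall_inner_eq_zero_iff hI hx hp _).1 h)
    · exact Or.inr ((forall_inner_eq_zero_iff hI hx hn _).1 fun j hj => by
        rw [inner_neg_left, h j hj, neg_zero])
  · intro h j hj
    have h0 : ∀ α ∈ I i.succ, inner ℝ α (x j) = 0 := fun α hα =>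
      (hx j).1 α (hI.2 (Fin.succ_le_succ_iff.2 (Fin.castSucc_lt_succ_iff.1 hj)) hα)
    rcases h with h | h
    · exact inner_eq_zero_of_mem_span h0 h
    · have := inner_eq_zero_of_mem_span h0 h
      rwa [inner_neg_left, neg_eq_zero] at this

theorem finrank_span_of_subset (hΔ : IsSimpleSystem Φ Δ) {J : Set V}
    (hJ : J ⊆ Δ) : Module.finrank ℝ (Submodule.span ℝ J) = J.ncard := by
  have h : LinearIndepOn ℝ id J := hΔ.linearIndep.mono hJ
  have := Module.finrank_eq_nat_card_basis (Module.Basis.span h.linearIndependent)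
  rwa [show Set.range (fun x : J => id (x : V)) = J from Subtype.range_coe] at this

/-- The roots vanishing on the first components are, up to sign, those in the cone of `I i.succ`, so
they span the same space as these independent simple roots. Defining the rank by such spans makes it
invariant under the group and monotone in the signs. -/
theorem finrank_span_zeroRoots (hΔ : IsSimpleSystem Φ Δ) {I : Fin (n + 1) → Set V}
    (hI : I ∈ flags Δ n) {x : Fin n → V} (hx : x ∈ stdStratum I) (i : Fin n) :
    Module.finrank ℝ (Submodule.span ℝ (zeroRoots Φ x i)) = (I i.succ).ncard := by
  rw [← finrank_span_of_subset hΔ (flags_subset hI i.succ)]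
  have : Submodule.span ℝ (zeroRoots Φ x i) = Submodule.span ℝ (I i.succ) := by
    apply le_antisymm
    · refine Submodule.span_le.2 fun β hβ => ?_
      rcases (mem_zeroRoots_iff hΔ hI hx hβ.1 i).1 hβ with h | h
      · exact mem_span_nnreal_imp h
      · exact neg_mem_iff.1 (mem_span_nnreal_imp h)
    · refine Submodule.span_mono fun α hα => ?_
      exact (mem_zeroRoots_iff hΔ hI hx (hΔ.subset (flags_subset hI _ hα)) i).2
        (Or.inl (Submodule.subset_span hα))
  rw [this]

theorem strataRank_eq (hΔ : IsSimpleSystem Φ Δ) {I : Fin (n + 1) → Set V}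
    (hI : I ∈ flags Δ n) {x : Fin n → V} (hx : x ∈ stdStratum I) :
    strataRank Φ Δ x = ∑ i : Fin n, (Δ.ncard - (I i.succ).ncard) :=
  Finset.sum_congr rfl fun i _ => by rw [finrank_span_zeroRoots hΔ hI hx]

theorem strataRank_update (hΦ : IsRootSystem Φ) (hΔ : IsSimpleSystem Φ Δ)
    {I : Fin (n + 1) → Set V} (hI : I ∈ flags Δ n) {i : Fin n} {α : V} (hα : α ∈ I i.castSucc)
    (hα' : α ∉ I i.succ) {x r : Fin n → V} (hx : x ∈ stdStratum I)
    (hr : r ∈ stdStratum (Function.update I i.succ (insert α (I i.succ)))) :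
    strataRank Φ Δ r + 1 = strataRank Φ Δ x := by
  classical
  have hΔfin : Δ.Finite := hΦ.finite.subset hΔ.subset
  rw [strataRank_eq hΔ hI hx, strataRank_eq hΔ (update_mem_flags hI hα) hr,
    ← Finset.add_sum_erase _ _ (Finset.mem_univ i),
    ← Finset.add_sum_erase Finset.univ (fun j : Fin n => Δ.ncard - (I j.succ).ncard)
      (Finset.mem_univ i), Function.update_self]
  have h1 : ∑ j ∈ Finset.univ.erase i, (Δ.ncard -
      (Function.update I i.succ (insert α (I i.succ)) j.succ).ncard) =
      ∑ j ∈ Finset.univ.erase i, (Δ.ncard - (I j.succ).ncard) := by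
    refine Finset.sum_congr rfl fun j hj => ?_
    rw [Function.update_of_ne fun h => (Finset.mem_erase.1 hj).1 (Fin.succ_injective n h)]
  have h2 := Set.ncard_insert_of_notMem hα' (hΔfin.subset (flags_subset hI _))
  have h3 : (insert α (I i.succ)).ncard ≤ Δ.ncard := Set.ncard_le_ncard
    (Set.insert_subset (flags_subset hI _ hα) (flags_subset hI _)) hΔfin
  rw [h1]
  omega

/-- Only finitely many strict inequalities `⟪β, x k⟫ < 0` have to survive a small perturbation. -/
theorem rootSigns_add_smul (hΦ : IsRootSystem Φ) (x r : Fin n → V) :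
    ∃ ε : ℝ, 0 < ε ∧ rootSigns Φ (x + ε • r) ⊆ rootSigns Φ x := by
  have := hΦ.finite.to_subtype
  have hev : ∀ᶠ ε : ℝ in nhdsWithin 0 (Set.Ioi 0), ∀ (β : Φ) (k : Fin n),
      inner ℝ β.1 (x k) < 0 → inner ℝ β.1 (x k) + ε * inner ℝ β.1 (r k) < 0 := by
    refine Filter.eventually_all.2 fun β => Filter.eventually_all.2 fun k => ?_
    by_cases h : inner ℝ β.1 (x k) < 0
    · have ht : Filter.Tendsto (fun ε : ℝ => inner ℝ β.1 (x k) + ε * inner ℝ β.1 (r k))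
          (nhdsWithin 0 (Set.Ioi 0)) (nhds (inner ℝ β.1 (x k) + 0 * inner ℝ β.1 (r k))) :=
        ((continuous_const.add (continuous_id.mul continuous_const)).tendsto 0).mono_left
          nhdsWithin_le_nhds
      rw [zero_mul, add_zero] at ht
      filter_upwards [ht.eventually_lt_const h] with ε hε using fun _ => hε
    · exact Filter.Eventually.of_forall fun ε h' => absurd h' h
  obtain ⟨ε, hε, hpos⟩ := (hev.and self_mem_nhdsWithin).exists
  refine ⟨ε, hpos, (lexNonneg_subset_iff (isSymmetricFamily_rootForm hΦ n)).2 ?_⟩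
  rintro ⟨β, k⟩ hp
  by_contra hlt
  have h1 := hε β k (not_le.1 hlt)
  have h2 := (mem_rootSigns.1 hp).2
  rw [Pi.add_apply, Pi.smul_apply, inner_add_right, real_inner_smul_right] at h2
  linarith

/-- Some strict inequality of the stratum of `y` degenerates at `x`; making it an equation enlarges
the flag by one root. A point `r` of the new stratum need not have `x` in the closure of its cell,
since the signs of `α` on later components of `x` are unconstrained. The point `x + ε • r` repairs
this: it has `x` in its closure and the same vanishing roots as `r`. -/
theorem exists_facet_of_mem_stdStratum [FiniteDimensional ℝ V] (hΦ : IsRootSystem Φ)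
    (hΔ : IsSimpleSystem Φ Δ) {I : Fin (n + 1) → Set V} (hI : I ∈ flags Δ n) {x y : Fin n → V}
    (hy : y ∈ stdStratum I) (hyx : rootSigns Φ y ⊆ rootSigns Φ x)
    (hxy : ¬rootSigns Φ x ⊆ rootSigns Φ y) :
    ∃ z, rootSigns Φ z ⊆ rootSigns Φ x ∧ rootSigns Φ y ⊆ rootSigns Φ z ∧
      strataRank Φ Δ z + 1 = strataRank Φ Δ y := by
  have hf := isSymmetricFamily_rootForm hΦ n
  have hzero : ∀ i : Fin n, ∀ α ∈ I i.succ, ∀ j ≤ i, inner ℝ α (x j) = 0 := by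
    intro i α hα j hj
    exact ((zeroRoots_mono hΦ hyx i) ((mem_zeroRoots_iff hΔ hI hy
      (hΔ.subset (flags_subset hI _ hα)) i).2 (Or.inl (Submodule.subset_span hα)))).2 j hj
  have hnonneg : ∀ i : Fin n, ∀ α ∈ I i.castSucc, 0 ≤ inner ℝ α (x i) := by
    intro i α hα
    have hαΦ := hΔ.subset (flags_subset hI _ hα)
    refine (hyx (show ((⟨α, hαΦ⟩ : Φ), i) ∈ rootSigns Φ y from ⟨fun j hj => ?_, ?_⟩)).2
    · exact (hy j).1 α (hI.2 (Fin.succ_le_castSucc_iff.2 hj) hα)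
    · exact inner_nonneg_of_mem_stdStratum hy i (Submodule.subset_span hα)
  -- Otherwise `x` would satisfy all conditions defining the stratum of `y` and have the same signs.
  obtain ⟨i, α, hα, hα', hαx⟩ : ∃ i : Fin n, ∃ α ∈ I i.castSucc, α ∉ I i.succ ∧
      inner ℝ α (x i) = 0 := by
    by_contra! hcon
    refine hxy (rootSigns_subset_of_flags_le hΔ hI hI (fun _ => subset_rfl) (fun i => ⟨?_, ?_⟩) hy)
    · exact fun α hα => hzero i α hα i le_rfl
    · exact fun α hα => lt_of_le_of_ne (hnonneg i α hα.1) (hcon i α hα.1 hα.2).symm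
  have hI' := update_mem_flags hI hα
  obtain ⟨r, hr⟩ := stdStratum_nonempty hΔ hI'
  have hyr : rootSigns Φ y ⊆ rootSigns Φ r :=
    rootSigns_subset_of_flags_le hΔ hI hI' (subset_update I i α) hy hr
  obtain ⟨ε, hε, hzx⟩ := rootSigns_add_smul hΦ x r
  refine ⟨x + ε • r, hzx, (lexNonneg_subset_iff hf).2 fun p hp => ?_, ?_⟩
  · rw [map_add, map_smul, smul_eq_mul]
    exact add_nonneg (hyx hp).2 (mul_nonneg hε.le (hyr hp).2)
  · rw [← strataRank_update hΦ hΔ hI hα hα' hy hr]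
    congr 1
    refine Finset.sum_congr rfl fun k _ => ?_
    have hrx : zeroRoots Φ r k ⊆ zeroRoots Φ x k := by
      intro β hβ
      have h0 : ∀ γ ∈ Function.update I i.succ (insert α (I i.succ)) k.succ, ∀ j ≤ k,
          inner ℝ γ (x j) = 0 := by
        intro γ hγ j hj
        by_cases hk : k = i
        · subst hk
          rw [Function.update_self] at hγ
          rcases hγ with rfl | hγ
          · rcases hj.lt_or_eq with hj | rfl
            · exact hzero j γ (hI.2 (Fin.succ_le_castSucc_iff.2 hj) hα) j le_rfl
            · exact hαx
          · exact hzero k γ hγ j hj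
        · rw [Function.update_of_ne fun h => hk (Fin.succ_injective n h)] at hγ
          exact hzero k γ hγ j hj
      refine ⟨hβ.1, fun j hj => ?_⟩
      rcases (mem_zeroRoots_iff hΔ hI' hr hβ.1 k).1 hβ with h | h
      · exact inner_eq_zero_of_mem_span (fun γ hγ => h0 γ hγ j hj) h
      · have := inner_eq_zero_of_mem_span (fun γ hγ => h0 γ hγ j hj) h
        rwa [inner_neg_left, neg_eq_zero] at this
    -- A root vanishing on the perturbed tuple vanishes on `x`, which lies in the closure of its
    -- cell, and hence on `r`; the converse is `hrx`.
    have hzr : zeroRoots Φ (x + ε • r) k = zeroRoots Φ r k := by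
      apply Set.Subset.antisymm
      · intro β hβ
        refine ⟨hβ.1, fun j hj => ?_⟩
        have h1 := hβ.2 j hj
        rw [Pi.add_apply, Pi.smul_apply, inner_add_right, real_inner_smul_right,
          (zeroRoots_mono hΦ hzx k hβ).2 j hj, zero_add] at h1
        exact (mul_eq_zero.1 h1).resolve_left hε.ne'
      · intro β hβ
        refine ⟨hβ.1, fun j hj => ?_⟩
        rw [Pi.add_apply, Pi.smul_apply, inner_add_right, real_inner_smul_right,
          (hrx hβ).2 j hj, hβ.2 j hj, mul_zero, add_zero]
    rw [hzr]

theorem strataRank_zero (hΔ : IsSimpleSystem Φ Δ) :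
    strataRank Φ Δ (0 : Fin n → V) = 0 := by
  rw [strataRank_eq hΔ (I := fun _ => Δ) ⟨rfl, antitone_const⟩ fun i => ⟨by simp, by simp⟩]
  simp

variable [FiniteDimensional ℝ V]

/-- In particular the rank depends only on the signs, so it is well defined on strata. -/
theorem strataRank_antitone (hΦ : IsRootSystem Φ) {x y : Fin n → V}
    (h : rootSigns Φ y ⊆ rootSigns Φ x) : strataRank Φ Δ x ≤ strataRank Φ Δ y :=
  Finset.sum_le_sum fun i _ => Nat.sub_le_sub_left
    (Submodule.finrank_mono (Submodule.span_mono (zeroRoots_mono hΦ h i))) _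

theorem exists_facet (hΦ : IsRootSystem Φ) (hΔ : IsSimpleSystem Φ Δ) {x y : Fin n → V}
    (hyx : rootSigns Φ y ⊆ rootSigns Φ x) (hxy : ¬rootSigns Φ x ⊆ rootSigns Φ y) :
    ∃ z, rootSigns Φ z ⊆ rootSigns Φ x ∧ rootSigns Φ y ⊆ rootSigns Φ z ∧
      strataRank Φ Δ z + 1 = strataRank Φ Δ y := by
  obtain ⟨⟨w, I, hw, hI, _⟩, y, hy, rfl⟩ := StratumIndex.exists_mem hΦ hΔ y
  obtain ⟨x, rfl⟩ : ∃ x' : Fin n → V, x = fun i => w (x' i) :=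
    ⟨fun i => w⁻¹ (x i), funext fun i => (w.apply_symm_apply (x i)).symm⟩
  simp only [rootSigns_map_subset_iff hΦ hw] at hyx hxy
  obtain ⟨z, h1, h2, h3⟩ := exists_facet_of_mem_stdStratum hΦ hΔ hI hy hyx hxy
  refine ⟨fun i => w (z i), ?_, ?_, ?_⟩
  · rwa [rootSigns_map_subset_iff hΦ hw]
  · exact (rootSigns_map_subset_iff hΦ hw z y).2 h2
  · rw [strataRank_map hΦ hw]
    exact h3.trans (strataRank_map hΦ hw y).symm

theorem exists_top_rank (hΦ : IsRootSystem Φ) (hΔ : IsSimpleSystem Φ Δ) (x : Fin n → V) :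
    ∃ z, rootSigns Φ z ⊆ rootSigns Φ x ∧ strataRank Φ Δ z = n * Δ.ncard := by
  obtain ⟨⟨w, I, hw, hI, _⟩, x, hx, rfl⟩ := StratumIndex.exists_mem hΦ hΔ x
  -- The smallest flag: the closure of its stratum contains all standard strata, and each of the `n`
  -- summands of its rank is `Δ.ncard`.
  let J : Fin (n + 1) → Set V := fun k => if k = 0 then Δ else ∅
  have hJ : J ∈ flags Δ n := by
    refine ⟨if_pos rfl, fun a b hab => ?_⟩
    by_cases hb : b = 0
    · have ha : a = 0 := le_antisymm (hb ▸ hab) (Fin.zero_le a)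
      rw [ha, hb]
    · simp only [J, if_neg hb]
      exact Set.empty_subset _
  obtain ⟨z, hz⟩ := stdStratum_nonempty hΔ hJ
  refine ⟨fun i => w (z i), (rootSigns_map_subset_iff hΦ hw x z).2 ?_, ?_⟩
  · refine rootSigns_subset_of_flags_le hΔ hJ hI (fun k => ?_) hz hx
    by_cases hk : k = 0
    · rw [hk, hI.1, hJ.1]
    · simp only [J, if_neg hk]
      exact Set.empty_subset _
  · rw [strataRank_map hΦ hw, strataRank_eq hΔ hJ hz]
    simp [J, Fin.succ_ne_zero]

end Rank

/-! ### The cell decompositions attached to the root system -/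

section Decomposition

variable {V : Type*} [NormedAddCommGroup V] [InnerProductSpace ℝ V] {Φ Δ : Set V} {n : ℕ}

theorem eq_zero_of_mem_span_of_forall (hΔ : IsSimpleSystem Φ Δ) {v : V}
    (hv : v ∈ Submodule.span ℝ Δ) (h : ∀ β ∈ Φ, inner ℝ β v = 0) : v = 0 := by
  have key : ∀ y ∈ Submodule.span ℝ Δ, inner ℝ y v = 0 := by
    intro y hy
    induction hy using Submodule.span_induction with
    | mem x hx => exact h x (hΔ.subset hx)
    | zero => simp
    | add x y _ _ hx hy => rw [inner_add_left, hx, hy, add_zero]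
    | smul a x _ hx => rw [real_inner_smul_left, hx, mul_zero]
  exact inner_self_eq_zero.1 (key v hv)

theorem root_mem_span (hΔ : IsSimpleSystem Φ Δ) {β : V} (hβ : β ∈ Φ) :
    β ∈ Submodule.span ℝ Δ := by
  rcases hΔ.posRoot_or_neg hβ with h | h
  · exact mem_span_nnreal_imp h.2
  · exact neg_mem_iff.1 (mem_span_nnreal_imp h.2)

theorem Stratum.rootSigns_of_mem_zero (hΦ : IsRootSystem Φ) (hΔ : IsSimpleSystem Φ Δ)
    {x : Fin n → V} (hx : x ∈ (Stratum.zero Φ Δ n).carrier) : rootSigns Φ x = rootSigns Φ 0 := by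
  rwa [Stratum.carrier_eq_lexCell hΦ hΔ _ Stratum.zero_mem_zero] at hx

/-- The forms defined by the roots on tuples of vectors of the span of the simple roots. -/
def spanRootForm (Φ Δ : Set V) (n : ℕ) (β : Φ) (i : Fin n) :
    (Fin n → Submodule.span ℝ Δ) →ₗ[ℝ] ℝ :=
  (rootForm Φ n β i).comp ((Submodule.span ℝ Δ).subtype.compLeft (Fin n))

theorem spanRootForm_apply (β : Φ) (i : Fin n) (x : Fin n → Submodule.span ℝ Δ) :
    spanRootForm Φ Δ n β i x = inner ℝ β.1 (x i : V) := rfl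

theorem rootForm_separating (hΔ : IsSimpleSystem Φ Δ) (hspan : Submodule.span ℝ Δ = ⊤)
    (x : Fin n → V) (h : ∀ b i, rootForm Φ n b i x = 0) : x = 0 := by
  funext i
  exact eq_zero_of_mem_span_of_forall hΔ (by rw [hspan]; trivial) fun β hβ => h ⟨β, hβ⟩ i

variable [FiniteDimensional ℝ V]

theorem rayCells_eq_strata (hΦ : IsRootSystem Φ) (hΔ : IsSimpleSystem Φ Δ)
    (hspan : Submodule.span ℝ Δ = ⊤) :
    {c | ∃ F : Stratum Φ Δ n, F ≠ Stratum.zero Φ Δ n ∧ c = raysOf F.carrier} =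
      rayCells (rootForm Φ n) := by
  -- Because the simple roots span `V`, the minimal stratum is just the origin, so omitting it
  -- agrees with omitting the zero vector.
  have hzero : ∀ F : Stratum Φ Δ n, ∀ x ∈ F.carrier, F = Stratum.zero Φ Δ n ↔ x = 0 := by
    intro F x hx
    constructor
    · rintro rfl
      have h2 := Stratum.rootSigns_of_mem_zero hΦ hΔ hx
      funext i
      refine eq_zero_of_mem_span_of_forall hΔ (by rw [hspan]; trivial) fun β hβ => ?_
      exact eq_zero_of_lexNonneg_subset (isSymmetricFamily_rootForm hΦ n) h2.ge (b := ⟨β, hβ⟩)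
        fun j _ => map_zero _
    · rintro rfl
      apply Stratum.ext_carrier
      rw [F.carrier_eq_lexCell hΦ hΔ hx, Stratum.carrier_eq_lexCell hΦ hΔ _ Stratum.zero_mem_zero]
  ext c
  constructor
  · rintro ⟨F, hF, rfl⟩
    obtain ⟨x, hx⟩ := F.carrier_nonempty hΔ
    exact ⟨x, fun h => hF ((hzero F x hx).2 h), by rw [F.carrier_eq_lexCell hΦ hΔ hx]⟩
  · rintro ⟨x, hx0, rfl⟩
    obtain ⟨F, hx⟩ := Stratum.exists_mem hΦ hΔ x
    exact ⟨F, fun h => hx0 ((hzero F x hx).1 h), by rw [F.carrier_eq_lexCell hΦ hΔ hx]⟩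

theorem exists_orderIso_strata (hΦ : IsRootSystem Φ) (hΔ : IsSimpleSystem Φ Δ)
    (hspan : Submodule.span ℝ Δ = ⊤) :
    ∃ e : {F : Stratum Φ Δ n // F ≠ Stratum.zero Φ Δ n} ≃o FacePoset (rayCells (rootForm Φ n)),
      ∀ F, (e F : Set (RaySpace (Fin n → V))) = closure (raysOf F.1.carrier) := by
  choose a ha using fun F : Stratum Φ Δ n => F.carrier_nonempty hΔ
  have hp₀ : rootSigns Φ (a (Stratum.zero Φ Δ n)) = Set.univ := by
    rw [Stratum.rootSigns_of_mem_zero hΦ hΔ (ha (Stratum.zero Φ Δ n))]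
    exact lexNonneg_zero
  obtain ⟨e, he⟩ := exists_orderIso_facePoset_rayCells (isSymmetricFamily_rootForm hΦ n)
    (rootForm_separating hΔ hspan) a (fun F G => Stratum.le_iff hΦ hΔ (ha F) (ha G))
    (Stratum.antisymm hΦ hΔ) (fun x => by
      obtain ⟨F, hF⟩ := Stratum.exists_mem hΦ hΔ x
      exact ⟨F, (F.carrier_eq_lexCell hΦ hΔ hF).subset (ha F)⟩) _ hp₀
  exact ⟨e, fun F => by rw [he, F.1.carrier_eq_lexCell hΦ hΔ (ha F.1)]⟩

theorem finrank_pi_eq (n : ℕ) : Module.finrank ℝ (Fin n → V) = n * Module.finrank ℝ V := by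
  rw [Module.finrank_pi_fintype, Finset.sum_const, Finset.card_univ, Fintype.card_fin, smul_eq_mul]

theorem nonempty_raySpace_homeo (n : ℕ) {d : ℕ} (hd : Module.finrank ℝ V = d) :
    Nonempty (RaySpace (Fin n → V) ≃ₜ StdSphere (n * d)) := by
  refine ⟨raySpaceHomeoSphere (ContinuousLinearEquiv.ofFinrankEq ?_)⟩
  rw [finrank_pi_eq, hd, finrank_euclideanSpace_fin]

/-- The face poset of the decomposition of the sphere of the span of the simple roots is the
index poset. -/
theorem exists_cellDecomposition_sphere (hΦ : IsRootSystem Φ) (hΔ : IsSimpleSystem Φ Δ) :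
    ∃ E : Set (Set (StdSphere (n * Δ.ncard))), IsRegularCellDecomposition E ∧
      Nonempty ({p : StratumIndex Φ Δ n // p ≠ StratumIndex.zero hΔ.subset n} ≃o FacePoset E) := by
  have := hΦ.finite.to_subtype
  set U := Submodule.span ℝ Δ with hU
  have hf : IsSymmetricFamily (spanRootForm Φ Δ n) := fun β =>
    ⟨⟨-β.1, hΦ.neg_mem β.2⟩, fun i => by
      ext x
      exact inner_neg_left _ _⟩
  have hsep : ∀ x, (∀ β i, spanRootForm Φ Δ n β i x = 0) → x = 0 := fun x h => funext fun i =>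
    Subtype.ext (eq_zero_of_mem_span_of_forall hΔ (x i).2 fun β hβ => h ⟨β, hβ⟩ i)
  -- Roots lie in `U`, so their pairings do not see the component orthogonal to `U`.
  have hproj : ∀ x : Fin n → V, lexNonneg (spanRootForm Φ Δ n)
      (fun i => U.orthogonalProjectionOnto (x i)) = rootSigns Φ x := by
    intro x
    have h1 : ∀ (β : Φ) (i : Fin n),
        inner ℝ β.1 (U.orthogonalProjectionOnto (x i) : V) = inner ℝ β.1 (x i) := fun β i =>
      U.inner_orthogonalProjectionOnto_eq_of_mem_left ⟨β.1, root_mem_span hΔ β.2⟩ (x i)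
    ext ⟨β, i⟩
    simp only [lexNonneg, Set.mem_ofPred_eq, spanRootForm_apply, rootForm_apply]
    simp only [h1]
  have hcoe : ∀ x : Fin n → U, lexNonneg (spanRootForm Φ Δ n) x =
      rootSigns Φ fun i => (x i : V) := fun x => rfl
  choose a ha using fun p : StratumIndex Φ Δ n => p.toStratum.carrier_nonempty hΔ
  have hp₀ : rootSigns Φ (a (StratumIndex.zero hΔ.subset n)) = Set.univ := by
    rw [Stratum.rootSigns_of_mem_zero hΦ hΔ (ha (StratumIndex.zero hΔ.subset n))]
    exact lexNonneg_zero
  obtain ⟨e, -⟩ := exists_orderIso_facePoset_rayCells hf hsep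
    (fun (p : StratumIndex Φ Δ n) i => U.orthogonalProjectionOnto (a p i))
    (fun p q => by rw [hproj, hproj]; exact Stratum.le_iff hΦ hΔ (ha p) (ha q))
    (fun p q h h' => (toStratum_bijective hΦ hΔ).1 (Stratum.antisymm hΦ hΔ _ _ h h'))
    (fun x => by
      obtain ⟨p, hp⟩ := StratumIndex.exists_mem hΦ hΔ fun i => (x i : V)
      refine ⟨p, ?_⟩
      rw [hproj, hcoe]
      exact (p.toStratum.carrier_eq_lexCell hΦ hΔ hp).subset (ha p))
    (StratumIndex.zero hΔ.subset n) (by rw [hproj, hp₀])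
  obtain ⟨φ⟩ := nonempty_raySpace_homeo (V := U) n (finrank_span_of_subset hΔ subset_rfl)
  exact ⟨_, (isRegularCellDecomposition_rayCells hf hsep).image φ,
    ⟨e.trans (facePosetImage _ φ)⟩⟩

theorem isGradedPoset_withTop_stratumIndex (hΦ : IsRootSystem Φ) (hΔ : IsSimpleSystem Φ Δ) :
    IsGradedPoset (WithTop (StratumIndex Φ Δ n)) := by
  choose a ha using fun p : StratumIndex Φ Δ n => p.toStratum.carrier_nonempty hΔ
  have hle : ∀ p q : StratumIndex Φ Δ n, p ≤ q ↔ rootSigns Φ (a q) ⊆ rootSigns Φ (a p) :=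
    fun p q => Stratum.le_iff hΦ hΔ (ha p) (ha q)
  have hrep : ∀ x : Fin n → V, ∃ p : StratumIndex Φ Δ n, rootSigns Φ (a p) = rootSigns Φ x := by
    intro x
    obtain ⟨p, hp⟩ := StratumIndex.exists_mem hΦ hΔ x
    exact ⟨p, (p.toStratum.carrier_eq_lexCell hΦ hΔ hp).subset (ha p)⟩
  have hrank : ∀ {x y : Fin n → V}, rootSigns Φ x = rootSigns Φ y →
      strataRank Φ Δ x = strataRank Φ Δ y := fun h =>
    le_antisymm (strataRank_antitone hΦ h.ge) (strataRank_antitone hΦ h.le)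
  refine isGradedPoset_withTop
    (fun p q h h' => (toStratum_bijective hΦ hΔ).1 (Stratum.antisymm hΦ hΔ _ _ h h'))
    (bot := StratumIndex.zero hΔ.subset n) (fun p => Stratum.isBot_zero hΦ hΔ p.toStratum)
    (fun p => strataRank Φ Δ (a p)) ?_ ?_ (n * Δ.ncard) ?_
  · rw [← strataRank_zero (n := n) hΔ]
    exact hrank (Stratum.rootSigns_of_mem_zero hΦ hΔ (ha (StratumIndex.zero hΔ.subset n)))
  · intro p q hpq
    obtain ⟨z, h1, h2, h3⟩ := exists_facet hΦ hΔ ((hle p q).1 hpq.le)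
      fun h => hpq.not_ge ((hle q p).2 h)
    obtain ⟨c, hc⟩ := hrep z
    have hcz := hrank hc
    refine ⟨c, (hle p c).2 (hc.trans_subset h1), lt_of_le_not_ge ((hle c q).2 (h2.trans hc.ge))
      fun h => ?_, by rw [hcz, h3]⟩
    have := strataRank_antitone (Δ := Δ) hΦ ((hle q c).1 h)
    omega
  · intro p
    obtain ⟨z, h1, h2⟩ := exists_top_rank hΦ hΔ (a p)
    obtain ⟨c, hc⟩ := hrep z
    exact ⟨c, (hle p c).2 (hc.trans_subset h1), (hrank hc).trans h2⟩

end Decomposition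

end DiagonalStrata

end

/-! ### The theorem -/

theorem proposition4p3 {V : Type*} [NormedAddCommGroup V] [InnerProductSpace ℝ V]
    [FiniteDimensional ℝ V] (Φ Δ : Set V) (hΦ : DiagonalStrata.IsRootSystem Φ)
    (hΔ : DiagonalStrata.IsSimpleSystem Φ Δ) (n : ℕ) (hn : 1 ≤ n) :
    -- the strata and their indices are partially ordered, with minimum `0̂`
    ((∀ F G : DiagonalStrata.Stratum Φ Δ n, F ≤ G → G ≤ F → F = G) ∧
      IsBot (DiagonalStrata.Stratum.zero Φ Δ n) ∧
      Function.Bijective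
        (DiagonalStrata.StratumIndex.toStratum : DiagonalStrata.StratumIndex Φ Δ n → _)) ∧
    -- if the simple roots span `V`, the `[F]` form a regular cell decomposition of the space of
    -- rays, a sphere, with face poset the poset of strata without `0̂`
    (Submodule.span ℝ Δ = ⊤ →
      Module.finrank ℝ V = Δ.ncard ∧
      Nonempty (DiagonalStrata.RaySpace (Fin n → V) ≃ₜ
        DiagonalStrata.StdSphere (n * Module.finrank ℝ V)) ∧
      DiagonalStrata.IsRegularCellDecomposition
        {c | ∃ F : DiagonalStrata.Stratum Φ Δ n, F ≠ DiagonalStrata.Stratum.zero Φ Δ n ∧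
          c = DiagonalStrata.raysOf F.carrier} ∧
      ∃ e : {F : DiagonalStrata.Stratum Φ Δ n // F ≠ DiagonalStrata.Stratum.zero Φ Δ n} ≃o
          DiagonalStrata.FacePoset
            {c | ∃ F : DiagonalStrata.Stratum Φ Δ n, F ≠ DiagonalStrata.Stratum.zero Φ Δ n ∧
              c = DiagonalStrata.raysOf F.carrier},
        ∀ F, (e F : Set (DiagonalStrata.RaySpace (Fin n → V))) =
          closure (DiagonalStrata.raysOf F.1.carrier)) ∧
    -- in general, the index poset without `0̂` is the face poset of a regular cell decomposition
    -- of the sphere of dimension `n |Δ| - 1`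
    (∃ E : Set (Set (DiagonalStrata.StdSphere (n * Δ.ncard))),
      DiagonalStrata.IsRegularCellDecomposition E ∧
      Nonempty ({p : DiagonalStrata.StratumIndex Φ Δ n //
          p ≠ DiagonalStrata.StratumIndex.zero hΔ.subset n} ≃o DiagonalStrata.FacePoset E)) ∧
    -- the index poset with a maximum adjoined is finite and graded
    Finite (WithTop (DiagonalStrata.StratumIndex Φ Δ n)) ∧
    DiagonalStrata.IsGradedPoset (WithTop (DiagonalStrata.StratumIndex Φ Δ n)) := by
  have hfin := DiagonalStrata.finite_stratum (n := n) hΦ hΔ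
  have : Finite (DiagonalStrata.StratumIndex Φ Δ n) :=
    Finite.of_injective _ (DiagonalStrata.toStratum_bijective hΦ hΔ).1
  refine ⟨⟨DiagonalStrata.Stratum.antisymm hΦ hΔ, DiagonalStrata.Stratum.isBot_zero hΦ hΔ,
    DiagonalStrata.toStratum_bijective hΦ hΔ⟩, fun hspan => ?_,
    DiagonalStrata.exists_cellDecomposition_sphere hΦ hΔ,
    inferInstanceAs (Finite (Option (DiagonalStrata.StratumIndex Φ Δ n))),
    DiagonalStrata.isGradedPoset_withTop_stratumIndex hΦ hΔ⟩
  have := hΦ.finite.to_subtype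
  refine ⟨?_, DiagonalStrata.nonempty_raySpace_homeo n rfl, ?_⟩
  · rw [← DiagonalStrata.finrank_span_of_subset hΔ subset_rfl, hspan, finrank_top]
  · rw [DiagonalStrata.rayCells_eq_strata hΦ hΔ hspan]
    exact ⟨DiagonalStrata.isRegularCellDecomposition_rayCells
      (DiagonalStrata.isSymmetricFamily_rootForm hΦ n)
      (DiagonalStrata.rootForm_separating hΔ hspan),
      DiagonalStrata.exists_orderIso_strata hΦ hΔ hspan⟩
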